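/- Let $d \ge 2$ and $\lambda = \frac{d-2}{2}$, and let $\mathcal P(\mathbb S^{d-1})$ be the set of Borel probability measures on the unit sphere $\mathbb S^{d-1} \subset \mathbb R^d$. For $f \in C[-1,1]$ and $\mu \in \mathcal P(\mathbb S^{d-1})$ put $$ I_f(\mu) = \int_{\mathbb S^{d-1}} \int_{\mathbb S^{d-1}} f(\langle x, y\rangle)\, d\mu(x)\, d\mu(y). $$ Let $$ f(t) \sim \sum_{n=0}^\infty \widehat f_n \, \frac{n+\lambda}{\lambda}\, C_n^\lambda(t) $$ be the expansion of $f$ in the Gegenbauer polynomials $C_n^\lambda$, which are orthogonal on $[-1,1]$ with respect to the weight $(1-t^2)^{\lambda - 1/2}$; that is, with $P_n = \frac{n+\lambda}{\lambda} C_n^\lambda$, $$ \widehat f_n = \frac{\int_{-1}^1 f(t) P_n(t) (1-t^2)^{\lambda-1/2}\,dt}{\int_{-1}^1 P_n(t)^2 (1-t^2)^{\lambda-1/2}\,dt}. $$ For $d = 2$, i.e. $\lambda = 0$, $P_n$ is understood as the limit as $\lambda \to 0$: $P_0 = 1$ and $P_n = 2T_n$ for $n \ge 1$, where $T_n$ is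 the Chebyshev polynomial of the first kind. Let $\mathcal H_n^d$ be the space of spherical harmonics of degree $n$, i.e. the restrictions to $\mathbb S^{d-1}$ of the real homogeneous harmonic polynomials of degree $n$ on $\mathbb R^d$. Assume that the set $N_+(f) = \{ n \ge 0 : \widehat f_n > 0 \}$ is finite. Then there exists a discrete measure $\mu^* \in \mathcal P(\mathbb S^{d-1})$ (a combination of finitely many point masses) such that $$ |\operatorname{supp} \mu^*| \le \sum_{n \in N_+(f) \cup \{0\}} \dim \mathcal H_n^d $$ and $\mu^*$ minimizes $I_f$ over $\mathcal P(\mathbb S^{d-1})$, i.e. $$ I_f(\mu^*) = \inf_{\mu \in \mathcal P(\mathbb S^{d-1})} I_f(\mu). $$ -/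

import Mathlib

open MeasureTheory

noncomputable section

namespace SphereEnergy

/-- The unit sphere `𝕊^{d-1}` of `ℝ^d`. -/
abbrev Sphere (d : ℕ) : Type :=
  Metric.sphere (0 : EuclideanSpace ℝ (Fin d)) 1

/-- The energy `I_f(μ) = ∫∫ f(⟨x, y⟩) dμ(x) dμ(y)`. -/
def energy (d : ℕ) (f : ℝ → ℝ) (μ : ProbabilityMeasure (Sphere d)) : ℝ :=
  ∫ x : Sphere d, ∫ y : Sphere d,
    f (inner ℝ (x : EuclideanSpace ℝ (Fin d)) (y : EuclideanSpace ℝ (Fin d)))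
      ∂(μ : Measure (Sphere d)) ∂(μ : Measure (Sphere d))

/-- A discrete measure: a combination of finitely many point masses. -/
def IsDiscrete {d : ℕ} (μ : ProbabilityMeasure (Sphere d)) : Prop :=
  ∃ (S : Finset (Sphere d)) (w : Sphere d → ENNReal),
    (μ : Measure (Sphere d)) = ∑ x ∈ S, w x • Measure.dirac x

/-- The Gegenbauer (ultraspherical) polynomial
`C_n^λ(t) = ∑_{k ≤ n/2} (-1)^k (λ)_{n-k} / (k! (n-2k)!) (2t)^{n-2k}`,
where `(λ)_m = λ (λ+1) ⋯ (λ+m-1)`. -/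
def gegenbauer (lam : ℝ) (n : ℕ) : Polynomial ℝ :=
  ∑ k ∈ Finset.range (n / 2 + 1),
    Polynomial.C ((-1) ^ k * (ascPochhammer ℝ (n - k)).eval lam
        / ((Nat.factorial k : ℝ) * (Nat.factorial (n - 2 * k) : ℝ)))
      * (2 * Polynomial.X) ^ (n - 2 * k)

/-- The parameter `λ = (d-2)/2`. -/
def lam (d : ℕ) : ℝ := ((d : ℝ) - 2) / 2

/-- The polynomials `((n+λ)/λ) C_n^λ` of the Gegenbauer expansion on `𝕊^{d-1}`. On the circle, where
`λ = 0`, this is the limit as `λ → 0`: the constant `1` for `n = 0` and `2 T_n` for `n ≥ 1`, with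
`T_n` the Chebyshev polynomial of the first kind. -/
def zonal (d n : ℕ) : Polynomial ℝ :=
  if d = 2 then
    if n = 0 then 1 else 2 * Polynomial.Chebyshev.T ℝ n
  else
    Polynomial.C (((n : ℝ) + lam d) / lam d) * gegenbauer (lam d) n

/-- The weight `ν(t) = (1-t²)^{λ-1/2}` on `[-1,1]`. -/
def weight (d : ℕ) (t : ℝ) : ℝ := (1 - t ^ 2) ^ (lam d - 1 / 2)

/-- The coefficient `f̂_n` of the orthogonal expansion
`f ∼ ∑ f̂_n ((n+λ)/λ) C_n^λ` in `L²([-1,1], ν(t) dt)`. -/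
def coeff (d : ℕ) (f : ℝ → ℝ) (n : ℕ) : ℝ :=
  (∫ t in (-1 : ℝ)..1, f t * (zonal d n).eval t * weight d t) /
    ∫ t in (-1 : ℝ)..1, (zonal d n).eval t ^ 2 * weight d t

/-- `N_+(f) = {n ≥ 0 : f̂_n > 0}`. -/
def posDegrees (d : ℕ) (f : ℝ → ℝ) : Set ℕ := {n | 0 < coeff d f n}

/-- The Laplace operator `∑ ∂²/∂x_i²` on polynomials in `d` variables. -/
def polyLaplacian (d : ℕ) : MvPolynomial (Fin d) ℝ →ₗ[ℝ] MvPolynomial (Fin d) ℝ :=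
  ∑ i : Fin d, (MvPolynomial.pderiv i).toLinearMap ∘ₗ (MvPolynomial.pderiv i).toLinearMap

/-- Restriction of polynomials on `ℝ^d` to functions on the unit sphere. -/
def restrictToSphere (d : ℕ) : MvPolynomial (Fin d) ℝ →ₗ[ℝ] (Sphere d → ℝ) where
  toFun p x := MvPolynomial.eval (fun i => (x : EuclideanSpace ℝ (Fin d)) i) p
  map_add' p q := by ext x; simp
  map_smul' c p := by ext x; simp [MvPolynomial.smul_eval]

/-- The space `H_n^d` of spherical harmonics of degree `n`: restrictions to `𝕊^{d-1}` of the
homogeneous harmonic polynomials of degree `n` on `ℝ^d`. -/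
def sphericalHarmonics (d n : ℕ) : Submodule ℝ (Sphere d → ℝ) :=
  (MvPolynomial.homogeneousSubmodule (Fin d) ℝ n ⊓ LinearMap.ker (polyLaplacian d)).map
    (restrictToSphere d)

end SphereEnergy

end

/-! Let `M` be the sum of the dimensions. If a finite set has more than `M` points, linear algebra
gives a nonzero signed weight `c` on it annihilating the harmonics of every degree in `N_+(f) ∪
{0}`. Degree 0 makes the total mass of `c` zero. In the formal expansion of the energy of `c`,
degrees in `N_+(f)` contribute nothing, and every other degree contributes a nonpositive coefficient
times a positive semidefinite form. So the energy of `c` is nonpositive, and along one of the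
directions `±c` the energy of a probability weight does not increase. Moving until a weight vanishes
removes a point; iterating leaves at most `M` points (`exists_card_le_finEnergy_le`). Weighted
`M`-tuples form a compact space, so a minimizer among them exists. It beats every finite
configuration, hence by approximation every probability measure (`le_integral_integral`).

Two analytic facts carry the sign of the energy. Schoenberg's positivity
(`sum_sum_eval_inner_nonneg`) comes from the Fischer product, for which zonal harmonics are
reproducing kernels. Since the Gegenbauer series of a continuous `f` need not converge, the termwise
sign argument is made rigorous by heat smoothing (`sum_mul_nonpos_of_ultraCoeff`). It uses only the
differential equation, so `IsUltraspherical` treats the circle and higher dimensions alike. -/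

namespace SphereEnergy

/-! ### Ultraspherical polynomials: orthogonality and weighted norms. -/

open Polynomial Set Filter Topology

/-- The ultraspherical weight `(1 - t²)^(l - 1/2)`. -/
noncomputable def ultraWeight (l t : ℝ) : ℝ := (1 - t ^ 2) ^ (l - 1 / 2)

/-- The ultraspherical differential operator `(1 - X²) p'' - (2l + 1) X p'`. -/
noncomputable def gegOp (l : ℝ) : ℝ[X] →ₗ[ℝ] ℝ[X] :=
  LinearMap.mulLeft ℝ (1 - X ^ 2) ∘ₗ derivative ∘ₗ derivative
    - LinearMap.mulLeft ℝ (C (2 * l + 1) * X) ∘ₗ derivative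

theorem gegOp_apply (l : ℝ) (p : ℝ[X]) :
    gegOp l p = (1 - X ^ 2) * derivative (derivative p) - C (2 * l + 1) * X * derivative p := rfl

/-- The (negated) eigenvalue of `gegOp l` on the ultraspherical polynomial of degree `n`. -/
def ultraEig (l : ℝ) (n : ℕ) : ℝ := n * (n + 2 * l)

/-- `p` is a positive multiple of the ultraspherical polynomial of degree `n` and parameter `l`. -/
structure IsUltraspherical (l : ℝ) (n : ℕ) (p : ℝ[X]) : Prop where
  natDegree_eq : p.natDegree = n
  leadingCoeff_pos : 0 < p.leadingCoeff
  ode : gegOp l p = -ultraEig l n • p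

theorem one_sub_sq_nonneg {t : ℝ} (ht : t ∈ Icc (-1 : ℝ) 1) : 0 ≤ 1 - t ^ 2 := by
  nlinarith [ht.1, ht.2]

theorem ultraWeight_nonneg (l : ℝ) {t : ℝ} (ht : t ∈ Icc (-1 : ℝ) 1) : 0 ≤ ultraWeight l t :=
  Real.rpow_nonneg (one_sub_sq_nonneg ht) _

theorem measurable_ultraWeight (l : ℝ) : Measurable (ultraWeight l) := by
  unfold ultraWeight
  fun_prop

theorem intervalIntegrable_ultraWeight {l : ℝ} (hl : 0 ≤ l) :
    IntervalIntegrable (ultraWeight l) volume (-1) 1 := by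
  -- On `[0, 1]`, `1 - t² ≥ 1 - t` and the exponent is at least `-1/2`. The summand `1` covers `t =
  -- 1`, where `0 ^ (l - 1/2)` equals `1` if `l = 1/2`.
  have h1 : IntervalIntegrable (fun t : ℝ => (1 - t) ^ (-1 / 2 : ℝ) + 1) volume 0 1 := by
    have := (intervalIntegral.intervalIntegrable_rpow' (a := 0) (b := 1) (r := -1 / 2)
      (by norm_num)).comp_sub_left 1
    exact IntervalIntegrable.add (by simpa using this.symm) intervalIntegrable_const
  have h0 : IntervalIntegrable (ultraWeight l) volume 0 1 := by
    refine h1.mono_fun (measurable_ultraWeight l).aestronglyMeasurable ?_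
    refine (ae_restrict_iff' measurableSet_uIoc).2 (ae_of_all _ fun t ht => ?_)
    rw [uIoc_of_le zero_le_one] at ht
    have hnn : 0 ≤ (1 - t) ^ (-1 / 2 : ℝ) := Real.rpow_nonneg (by linarith [ht.2]) _
    beta_reduce
    rw [Real.norm_of_nonneg (ultraWeight_nonneg l ⟨by linarith [ht.1], ht.2⟩),
      Real.norm_of_nonneg (by positivity)]
    unfold ultraWeight
    rcases eq_or_lt_of_le ht.2 with rfl | h
    · have : ((1 : ℝ) - 1 ^ 2) ^ (l - 1 / 2) ≤ 1 := by
        norm_num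
        exact Real.zero_rpow_le_one _
      linarith
    · have hx : 0 < 1 - t ^ 2 := by nlinarith [ht.1]
      calc (1 - t ^ 2) ^ (l - 1 / 2) ≤ (1 - t ^ 2) ^ (-1 / 2 : ℝ) :=
            Real.rpow_le_rpow_of_exponent_ge hx (by nlinarith [ht.1]) (by linarith)
        _ ≤ (1 - t) ^ (-1 / 2 : ℝ) :=
            Real.rpow_le_rpow_of_nonpos (by linarith) (by nlinarith [ht.1]) (by norm_num)
        _ ≤ _ := by linarith
  refine IntervalIntegrable.trans (b := 0) ?_ h0
  have := (h0.comp_sub_left 0).symm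
  have he : (fun t => ultraWeight l (0 - t)) = ultraWeight l := by
    ext t
    simp [ultraWeight]
  rw [he] at this
  simpa using this

theorem intervalIntegrable_mul_ultraWeight {l : ℝ} (hl : 0 ≤ l) {g : ℝ → ℝ}
    (hg : ContinuousOn g (Icc (-1) 1)) :
    IntervalIntegrable (fun t => g t * ultraWeight l t) volume (-1) 1 :=
  (intervalIntegrable_ultraWeight hl).continuousOn_mul (by rwa [uIcc_of_le (by norm_num)])

theorem ultraWeight_add_one {l : ℝ} (hl : 0 ≤ l) {t : ℝ} (ht : t ∈ Icc (-1 : ℝ) 1) :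
    ultraWeight (l + 1) t = (1 - t ^ 2) * ultraWeight l t := by
  unfold ultraWeight
  rw [show l + 1 - 1 / 2 = (l - 1 / 2) + 1 by ring,
    Real.rpow_add_one' (one_sub_sq_nonneg ht) (by linarith), mul_comm]

/-- Integration by parts for the ultraspherical operator. -/
theorem integral_gegOp_mul {l : ℝ} (hl : 0 ≤ l) (u v : ℝ[X]) :
    ∫ t in (-1 : ℝ)..1, (gegOp l u).eval t * v.eval t * ultraWeight l t =
      -∫ t in (-1 : ℝ)..1,
        (derivative u).eval t * (derivative v).eval t * ultraWeight (l + 1) t := by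
  have hi1 : IntervalIntegrable
      (fun t => (gegOp l u).eval t * v.eval t * ultraWeight l t) volume (-1) 1 :=
    intervalIntegrable_mul_ultraWeight hl (by fun_prop)
  have hi2 : IntervalIntegrable (fun t =>
      (derivative u).eval t * (derivative v).eval t * ultraWeight (l + 1) t) volume (-1) 1 :=
    intervalIntegrable_mul_ultraWeight (by linarith) (by fun_prop)
  -- Sturm–Liouville form: the weight times `gegOp l u` is the derivative of `(1 - t²)^(l + 1/2)
  -- u'`. The boundary terms vanish because `l + 1/2 > 0`.
  rw [eq_neg_iff_add_eq_zero, ← intervalIntegral.integral_add hi1 hi2,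
    intervalIntegral.integral_eq_sub_of_hasDerivAt_of_le
      (f := fun t => (1 - t ^ 2) ^ (l + 1 / 2) * ((derivative u).eval t * v.eval t))
      (by norm_num) _ _ (hi1.add hi2)]
  · have : l + 1 / 2 ≠ 0 := by linarith
    norm_num
    rw [Real.zero_rpow this]
    simp
  · refine ContinuousOn.mul (ContinuousOn.rpow_const (by fun_prop) fun t _ => Or.inr (by linarith))
      (by fun_prop)
  · intro t ht
    have hx : 0 < 1 - t ^ 2 := by nlinarith [ht.1, ht.2]
    have h1 : HasDerivAt (fun t : ℝ => (1 - t ^ 2) ^ (l + 1 / 2))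
        (-(2 * t) * (l + 1 / 2) * (1 - t ^ 2) ^ (l + 1 / 2 - 1)) t := by
      have : HasDerivAt (fun t : ℝ => 1 - t ^ 2) (-(2 * t)) t := by
        simpa using (hasDerivAt_pow 2 t).const_sub 1
      exact this.rpow_const (Or.inl hx.ne')
    have h2 := h1.mul (((derivative u).hasDerivAt t).mul (v.hasDerivAt t))
    refine h2.congr_deriv ?_
    rw [ultraWeight_add_one hl ⟨ht.1.le, ht.2.le⟩]
    have e1 : (1 - t ^ 2) ^ (l + 1 / 2) = (1 - t ^ 2) * ultraWeight l t := by
      rw [← ultraWeight_add_one hl ⟨ht.1.le, ht.2.le⟩, ultraWeight]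
      ring_nf
    have e2 : (1 - t ^ 2) ^ (l + 1 / 2 - 1) = ultraWeight l t := by
      rw [ultraWeight]
      ring_nf
    simp only [e1, e2, gegOp_apply, eval_sub, eval_mul, eval_one, eval_pow, eval_X, eval_C,
      Pi.mul_apply]
    ring

theorem integral_gegOp_mul_comm {l : ℝ} (hl : 0 ≤ l) (u v : ℝ[X]) :
    ∫ t in (-1 : ℝ)..1, (gegOp l u).eval t * v.eval t * ultraWeight l t =
      ∫ t in (-1 : ℝ)..1, u.eval t * (gegOp l v).eval t * ultraWeight l t := by
  rw [integral_gegOp_mul hl]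
  simp_rw [mul_comm (eval _ u)]
  rw [integral_gegOp_mul hl]
  simp_rw [mul_comm (eval _ (derivative u))]

theorem ultraEig_strictMono {l : ℝ} (hl : 0 ≤ l) : StrictMono (ultraEig l) := by
  intro m n h
  have h' : (m : ℝ) < n := by exact_mod_cast h
  have : (0 : ℝ) ≤ m := by positivity
  unfold ultraEig
  nlinarith

theorem ultraEig_nonneg {l : ℝ} (hl : 0 ≤ l) (n : ℕ) : 0 ≤ ultraEig l n := by
  unfold ultraEig
  positivity

/-- The operator is symmetric for the weight, and distinct degrees have distinct eigenvalues. -/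
theorem IsUltraspherical.orthogonal {l : ℝ} (hl : 0 ≤ l) {m n : ℕ} (hmn : m ≠ n) {p q : ℝ[X]}
    (hp : IsUltraspherical l m p) (hq : IsUltraspherical l n q) :
    ∫ t in (-1 : ℝ)..1, p.eval t * q.eval t * ultraWeight l t = 0 := by
  have h := integral_gegOp_mul_comm hl p q
  rw [hp.ode, hq.ode] at h
  simp only [eval_smul, smul_eq_mul] at h
  have e1 : ∀ t, -ultraEig l m * p.eval t * q.eval t * ultraWeight l t
      = -ultraEig l m * (p.eval t * q.eval t * ultraWeight l t) := fun t => by ring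
  have e2 : ∀ t, p.eval t * (-ultraEig l n * q.eval t) * ultraWeight l t
      = -ultraEig l n * (p.eval t * q.eval t * ultraWeight l t) := fun t => by ring
  simp_rw [e1, e2, intervalIntegral.integral_const_mul] at h
  have hne : ultraEig l m ≠ ultraEig l n := (ultraEig_strictMono hl).injective.ne hmn
  have : (ultraEig l n - ultraEig l m) *
      ∫ t in (-1 : ℝ)..1, p.eval t * q.eval t * ultraWeight l t = 0 := by linarith
  exact (mul_eq_zero.1 this).resolve_left (sub_ne_zero.2 hne.symm)

/-- Differentiating the differential equation raises the parameter by one. This permits induction on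
the degree with `l + n` fixed. -/
theorem IsUltraspherical.derivative_add_one {l : ℝ} {n : ℕ} {p : ℝ[X]}
    (hp : IsUltraspherical l (n + 1) p) : IsUltraspherical (l + 1) n (derivative p) := by
  have hd : (derivative p).natDegree = n := by
    rw [natDegree_derivative, hp.natDegree_eq, Nat.add_sub_cancel]
  have hc : p.coeff (n + 1) = p.leadingCoeff := by rw [leadingCoeff, hp.natDegree_eq]
  refine ⟨hd, ?_, ?_⟩
  · rw [leadingCoeff, hd, coeff_derivative, hc]
    have := hp.leadingCoeff_pos
    positivity
  · have h := congr_arg Polynomial.derivative hp.ode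
    simp only [gegOp_apply, derivative_sub, derivative_mul, derivative_one, derivative_X_pow,
      derivative_C, derivative_X, smul_eq_C_mul, ultraEig] at h
    simp only [gegOp_apply, smul_eq_C_mul, ultraEig]
    simp only [map_mul, map_add, map_one, map_neg, map_natCast, Nat.cast_add, Nat.cast_one,
      C_ofNat] at h ⊢
    linear_combination (norm := (push_cast; ring_nf)) h

/-- Only `[-1/2, 1/2]` is kept, an interval of length one where `1 - t² ≥ 3/4`. -/
theorem le_integral_ultraWeight {l : ℝ} (hl : 0 ≤ l) :
    (3 / 4 : ℝ) ^ l ≤ ∫ t in (-1 : ℝ)..1, ultraWeight l t := by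
  have hi := intervalIntegrable_ultraWeight hl
  have hsub : ∫ t in (-1 / 2 : ℝ)..(1 / 2), ultraWeight l t ≤
      ∫ t in (-1 : ℝ)..1, ultraWeight l t := by
    refine intervalIntegral.integral_mono_interval (by norm_num) (by norm_num) (by norm_num) ?_ hi
    exact (ae_restrict_iff' measurableSet_Ioc).2
      (ae_of_all _ fun t ht => ultraWeight_nonneg l ⟨ht.1.le, ht.2⟩)
  refine le_trans ?_ hsub
  have hc : ∫ t in (-1 / 2 : ℝ)..(1 / 2), (3 / 4 : ℝ) ^ l = (3 / 4 : ℝ) ^ l := by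
    rw [intervalIntegral.integral_const]
    norm_num
  rw [← hc]
  refine intervalIntegral.integral_mono_on (by norm_num) intervalIntegrable_const
    (hi.mono_set ?_) fun t ht => ?_
  · rw [uIcc_of_le (by norm_num), uIcc_of_le (by norm_num)]
    exact Icc_subset_Icc (by norm_num) (by norm_num)
  · have h1 : 3 / 4 ≤ 1 - t ^ 2 := by nlinarith [ht.1, ht.2]
    calc (3 / 4 : ℝ) ^ l ≤ (1 - t ^ 2) ^ l := Real.rpow_le_rpow (by norm_num) h1 hl
      _ ≤ (1 - t ^ 2) ^ (l - 1 / 2) :=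
          Real.rpow_le_rpow_of_exponent_ge (by linarith) (by nlinarith) (by linarith)

/-- A lower bound for the weighted `L²` norm in terms of the leading coefficient. -/
theorem IsUltraspherical.le_integral_sq {n : ℕ} : ∀ {l : ℝ}, 0 ≤ l → ∀ {p : ℝ[X]},
    IsUltraspherical l n p →
    (3 / 4 : ℝ) ^ (l + n) * p.leadingCoeff ^ 2 ≤
      (2 * (l + n)) ^ n * ∫ t in (-1 : ℝ)..1, p.eval t ^ 2 * ultraWeight l t := by
  induction n with
  | zero =>
    intro l hl p hp
    obtain ⟨c, rfl⟩ := natDegree_eq_zero.1 hp.natDegree_eq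
    simp only [eval_C, leadingCoeff_C, intervalIntegral.integral_const_mul, Nat.cast_zero,
      add_zero, pow_zero, one_mul]
    rw [mul_comm]
    exact mul_le_mul_of_nonneg_left (le_integral_ultraWeight hl) (sq_nonneg c)
  | succ n ih =>
    intro l hl p hp
    have h := ih (by linarith : (0 : ℝ) ≤ l + 1) hp.derivative_add_one
    have hlc : (Polynomial.derivative p).leadingCoeff = p.leadingCoeff * (n + 1) := by
      rw [leadingCoeff, hp.derivative_add_one.natDegree_eq, coeff_derivative, leadingCoeff, hp.natDegree_eq]
    -- Integration by parts with `u = v = p` turns the norm of `p'` for `l + 1` into the eigenvalue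
    -- times the norm of `p` for `l`.
    have hI := integral_gegOp_mul hl p p
    rw [hp.ode] at hI
    simp only [eval_smul, smul_eq_mul] at hI
    have e1 : ∀ t, -ultraEig l (n + 1) * p.eval t * p.eval t * ultraWeight l t
      = -ultraEig l (n + 1) * (p.eval t ^ 2 * ultraWeight l t) := fun t => by ring
    have e2 : ∀ t, (Polynomial.derivative p).eval t * (Polynomial.derivative p).eval t
      * ultraWeight (l + 1) t
      = (Polynomial.derivative p).eval t ^ 2 * ultraWeight (l + 1) t := fun t => by ring
    simp_rw [e1, e2, intervalIntegral.integral_const_mul] at hI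
    have hI' : ∫ t in (-1 : ℝ)..1, (Polynomial.derivative p).eval t ^ 2 * ultraWeight (l + 1) t
        = ultraEig l (n + 1) * ∫ t in (-1 : ℝ)..1, p.eval t ^ 2 * ultraWeight l t := by linarith
    rw [hI', hlc, show l + 1 + (n : ℝ) = l + ((n + 1 : ℕ) : ℝ) by push_cast; ring] at h
    set J := ∫ t in (-1 : ℝ)..1, p.eval t ^ 2 * ultraWeight l t
    have hJ : 0 ≤ J := intervalIntegral.integral_nonneg (by norm_num)
      fun t ht => mul_nonneg (sq_nonneg _) (ultraWeight_nonneg l ht)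
    set A := (3 / 4 : ℝ) ^ (l + ((n + 1 : ℕ) : ℝ))
    set B := (2 * (l + ((n + 1 : ℕ) : ℝ))) with hB
    have hA : 0 ≤ A := by positivity
    have hB0 : 0 ≤ B := by positivity
    have hn : (0 : ℝ) ≤ n := by positivity
    have h1 : ultraEig l (n + 1) ≤ (n + 1) * B := by
      rw [hB]; unfold ultraEig; push_cast; nlinarith
    have hlead := sq_nonneg p.leadingCoeff
    have h2 : (n + 1) * (A * p.leadingCoeff ^ 2) ≤ (n + 1) * (B ^ (n + 1) * J) := by
      calc (n + 1) * (A * p.leadingCoeff ^ 2)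
          ≤ (n + 1) * ((n + 1) * (A * p.leadingCoeff ^ 2)) := by
            have : 0 ≤ A * p.leadingCoeff ^ 2 := by positivity
            nlinarith [mul_nonneg hn (mul_nonneg (by linarith : (0 : ℝ) ≤ n + 1) this)]
        _ = A * (p.leadingCoeff * (n + 1)) ^ 2 := by ring
        _ ≤ B ^ n * (ultraEig l (n + 1) * J) := h
        _ ≤ B ^ n * ((n + 1) * B * J) := by gcongr
        _ = _ := by ring
    exact le_of_mul_le_mul_left h2 (by positivity)

end SphereEnergy

/-! ### Coefficient recurrence and sup-norm bounds. -/

namespace SphereEnergy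

open Polynomial Set Filter Topology

theorem coeff_gegOp (l : ℝ) (p : ℝ[X]) (m : ℕ) :
    (gegOp l p).coeff m = (m + 1) * (m + 2) * p.coeff (m + 2) - ultraEig l m * p.coeff m := by
  have e : gegOp l p = derivative (derivative p) - X ^ 2 * derivative (derivative p)
      - C (2 * l + 1) * (X ^ 1 * derivative p) := by
    rw [gegOp_apply]
    ring
  rw [e, coeff_sub, coeff_sub, coeff_C_mul, coeff_X_pow_mul', coeff_X_pow_mul', ultraEig]
  rcases m with _ | _ | m <;> simp [coeff_derivative] <;> ring

/-- The differential equation is equivalent to a two-step recurrence on coefficients, which is what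
explicit formulas can verify. -/
theorem IsUltraspherical.of_coeff {l : ℝ} {n : ℕ} {p : ℝ[X]} (hd : p.natDegree = n)
    (hlc : 0 < p.leadingCoeff)
    (h : ∀ m : ℕ, (m + 1) * (m + 2) * p.coeff (m + 2)
      = (ultraEig l m - ultraEig l n) * p.coeff m) :
    IsUltraspherical l n p := by
  refine ⟨hd, hlc, ?_⟩
  ext m
  rw [coeff_gegOp, h, coeff_smul, smul_eq_mul]
  ring

theorem IsUltraspherical.coeff_rec {l : ℝ} {n : ℕ} {p : ℝ[X]} (hp : IsUltraspherical l n p)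
    (m : ℕ) : (m + 1) * (m + 2) * p.coeff (m + 2)
      = (ultraEig l m - ultraEig l n) * p.coeff m := by
  have h := congr_arg (fun q => q.coeff m) hp.ode
  simp only [coeff_gegOp, coeff_smul, smul_eq_mul] at h
  linarith

theorem IsUltraspherical.coeff_self {l : ℝ} {n : ℕ} {p : ℝ[X]} (hp : IsUltraspherical l n p) :
    p.coeff n = p.leadingCoeff := by
  rw [leadingCoeff, hp.natDegree_eq]

theorem IsUltraspherical.coeff_eq_zero_of_lt {l : ℝ} {n : ℕ} {p : ℝ[X]}
    (hp : IsUltraspherical l n p) {m : ℕ} (h : n < m) : p.coeff m = 0 :=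
  coeff_eq_zero_of_natDegree_lt (hp.natDegree_eq ▸ h)

/-- Parity: the recurrence, run downwards from the vanishing coefficient of degree `n + 1`, never
divides by zero because the eigenvalues are distinct. -/
theorem IsUltraspherical.coeff_eq_zero_of_odd {l : ℝ} (hl : 0 ≤ l) {n : ℕ} {p : ℝ[X]}
    (hp : IsUltraspherical l n p) (k m : ℕ) (h : m + 2 * k + 1 = n) : p.coeff m = 0 := by
  have hne : ultraEig l m - ultraEig l n ≠ 0 :=
    sub_ne_zero.2 ((ultraEig_strictMono hl).injective.ne (by lia))
  have hz : p.coeff (m + 2) = 0 := by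
    induction k generalizing m with
    | zero => exact hp.coeff_eq_zero_of_lt (by lia)
    | succ k ih =>
      have hne' : ultraEig l (m + 2) - ultraEig l n ≠ 0 :=
        sub_ne_zero.2 ((ultraEig_strictMono hl).injective.ne (by lia))
      have hz := ih (m + 2) (by lia) hne'
      have := hp.coeff_rec (m + 2)
      rw [hz, mul_zero] at this
      exact (mul_eq_zero.1 this.symm).resolve_left hne'
  have := hp.coeff_rec m
  rw [hz, mul_zero] at this
  exact (mul_eq_zero.1 this.symm).resolve_left hne

/-- Each downward step of two degrees costs at most `n²`: the numerator `(m+1)(m+2)` is at most `n²`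
and the eigenvalue gap is at least `n ≥ 1`. -/
theorem IsUltraspherical.abs_coeff_le {l : ℝ} (hl : 0 ≤ l) {n : ℕ} {p : ℝ[X]}
    (hp : IsUltraspherical l n p) (j m : ℕ) (h : m + j = n) :
    |p.coeff m| ≤ (n : ℝ) ^ j * p.leadingCoeff := by
  have hlc := hp.leadingCoeff_pos
  induction j using Nat.strong_induction_on generalizing m with
  | _ j ih =>
    rcases j with _ | _ | j
    · obtain rfl : m = n := by lia
      simp [hp.coeff_self, abs_of_pos hlc]
    · rw [hp.coeff_eq_zero_of_odd hl 0 m (by lia)]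
      simp only [abs_zero]
      positivity
    · have hm := ih j (by lia) (m + 2) (by lia)
      have hr := congr_arg abs (hp.coeff_rec m)
      have hn : (m : ℝ) + (j + 1 + 1) = n := by exact_mod_cast h
      have hj : (0 : ℝ) ≤ j := by positivity
      have hm0 : (0 : ℝ) ≤ m := by positivity
      have hlow : (n : ℝ) ≤ ultraEig l n - ultraEig l m := by
        unfold ultraEig
        nlinarith [mul_nonneg hl hj]
      rw [abs_mul, abs_mul (_ - _), abs_of_nonneg (by positivity : (0 : ℝ) ≤ (m + 1) * (m + 2)),
        abs_sub_comm (ultraEig l m), abs_of_nonneg ((Nat.cast_nonneg n).trans hlow)] at hr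
      have hnpos : (0 : ℝ) < n := by linarith
      have hmm : ((m : ℝ) + 1) * (m + 2) ≤ n * n := by nlinarith
      have h1 : (n : ℝ) * |p.coeff m| ≤ n * ((n : ℝ) ^ (j + 1 + 1) * p.leadingCoeff) := by
        calc (n : ℝ) * |p.coeff m| ≤ (ultraEig l n - ultraEig l m) * |p.coeff m| := by gcongr
          _ = (m + 1) * (m + 2) * |p.coeff (m + 2)| := hr.symm
          _ ≤ (n * n) * ((n : ℝ) ^ j * p.leadingCoeff) := by gcongr
          _ = 1 * ((n : ℝ) ^ (j + 1 + 1) * p.leadingCoeff) := by ring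
          _ ≤ _ := by
            gcongr
            linarith
      exact le_of_mul_le_mul_left h1 hnpos

/-- A crude bound for the sup norm in terms of the leading coefficient. -/
theorem IsUltraspherical.abs_eval_le {l : ℝ} (hl : 0 ≤ l) {n : ℕ} {p : ℝ[X]}
    (hp : IsUltraspherical l n p) {t : ℝ} (ht : t ∈ Icc (-1 : ℝ) 1) :
    |p.eval t| ≤ (n + 1) * (n : ℝ) ^ n * p.leadingCoeff := by
  have hlc := hp.leadingCoeff_pos
  rw [eval_eq_sum_range, hp.natDegree_eq]
  have hb : ∀ m ∈ Finset.range (n + 1),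
      |p.coeff m * t ^ m| ≤ (n : ℝ) ^ n * p.leadingCoeff := by
    intro m hm
    have hm' : m ≤ n := Nat.lt_succ_iff.1 (Finset.mem_range.1 hm)
    have ht1 : |t ^ m| ≤ 1 := by
      rw [abs_pow]
      exact pow_le_one₀ (abs_nonneg t) (abs_le.2 ht)
    rw [abs_mul]
    calc |p.coeff m| * |t ^ m| ≤ |p.coeff m| * 1 := by gcongr
      _ ≤ (n : ℝ) ^ (n - m) * p.leadingCoeff := by
        rw [mul_one]
        exact hp.abs_coeff_le hl (n - m) m (by lia)
      _ ≤ (n : ℝ) ^ n * p.leadingCoeff := by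
        rcases Nat.eq_zero_or_pos n with rfl | hn
        · simp
        · gcongr
          · exact_mod_cast hn
          · lia
  calc |∑ m ∈ Finset.range (n + 1), p.coeff m * t ^ m|
      ≤ ∑ m ∈ Finset.range (n + 1), |p.coeff m * t ^ m| := Finset.abs_sum_le_sum_abs _ _
    _ ≤ ∑ m ∈ Finset.range (n + 1), (n : ℝ) ^ n * p.leadingCoeff := Finset.sum_le_sum hb
    _ = _ := by
      rw [Finset.sum_const, Finset.card_range, nsmul_eq_mul]
      push_cast
      ring

/-! ### Maximum principle and the heat semigroup. -/

/-- At a maximum point on `[-1, 1]` the ultraspherical operator is nonpositive. -/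
theorem eval_gegOp_nonpos_of_isMaxOn {l : ℝ} (hl : 0 ≤ l) (u : ℝ[X]) {t : ℝ}
    (ht : t ∈ Icc (-1 : ℝ) 1) (hmax : IsMaxOn (fun x => u.eval x) (Icc (-1) 1) t) :
    (gegOp l u).eval t ≤ 0 := by
  have hgen : (gegOp l u).eval t = (1 - t ^ 2) * (derivative (derivative u)).eval t
      - (2 * l + 1) * t * (derivative u).eval t := by
    simp [gegOp_apply]
  have hmax' : ∀ x ∈ Icc (-1 : ℝ) 1, u.eval x ≤ u.eval t := fun x hx => hmax hx
  rcases eq_or_lt_of_le ht.1 with rfl | h1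
  -- At an endpoint the second-order term vanishes, and the one-sided slope fixes the sign of the
  -- first-order term.
  · have hd : (derivative u).eval (-1) ≤ 0 := by
      have hs := (hasDerivWithinAt_iff_tendsto_slope' (by simp)).1
        ((u.hasDerivAt (-1)).hasDerivWithinAt (s := Ioi (-1)))
      refine le_of_tendsto hs ?_
      filter_upwards [Ioo_mem_nhdsGT (by norm_num : (-1 : ℝ) < 1)] with x hx
      rw [slope_def_field]
      exact div_nonpos_of_nonpos_of_nonneg (by linarith [hmax' x ⟨hx.1.le, hx.2.le⟩])
        (by linarith [hx.1])
    rw [hgen]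
    nlinarith
  rcases eq_or_lt_of_le ht.2 with rfl | h2
  · have hd : 0 ≤ (derivative u).eval 1 := by
      have hs := (hasDerivWithinAt_iff_tendsto_slope' (by simp)).1
        ((u.hasDerivAt 1).hasDerivWithinAt (s := Iio 1))
      refine ge_of_tendsto hs ?_
      filter_upwards [Ioo_mem_nhdsLT (by norm_num : (-1 : ℝ) < 1)] with x hx
      rw [slope_def_field]
      exact div_nonneg_of_nonpos (by linarith [hmax' x ⟨hx.1.le, hx.2.le⟩])
        (by linarith [hx.2])
    rw [hgen]
    nlinarith
  · have hloc : IsLocalMax (fun x => u.eval x) t := hmax.isLocalMax (Icc_mem_nhds h1 h2)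
    have hdu : deriv (fun x => u.eval x) = fun x => (derivative u).eval x := by
      ext x
      exact u.deriv
    have hd0 : (derivative u).eval t = 0 := by
      rw [← hloc.deriv_eq_zero, hdu]
    have hd2 : (derivative (derivative u)).eval t ≤ 0 := by
      -- A positive second derivative would make `t` a local minimum too, so `u` would be locally
      -- constant, forcing `u'' = 0`.
      by_contra! hpos
      have hmin := isLocalMin_of_deriv_deriv_pos (f := fun x => u.eval x) (x₀ := t)
        (by rw [hdu, Polynomial.deriv]; exact hpos) hloc.deriv_eq_zero (by fun_prop)
      have hconst : (fun x => u.eval x) =ᶠ[𝓝 t] fun _ => u.eval t := by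
        filter_upwards [hloc, hmin] with x hx1 hx2 using le_antisymm hx1 hx2
      have h3 := hconst.deriv.deriv_eq
      rw [hdu, Polynomial.deriv] at h3
      simp only [deriv_const', deriv_const] at h3
      linarith
    rw [hgen, hd0]
    have : 0 ≤ 1 - t ^ 2 := one_sub_sq_nonneg ht
    nlinarith

/-- The maximum principle for the resolvent of the ultraspherical operator. -/
theorem eval_le_of_resolvent_le {l : ℝ} (hl : 0 ≤ l) {ε : ℝ} (hε : 0 ≤ ε) (u : ℝ[X]) {M : ℝ}
    (h : ∀ t ∈ Icc (-1 : ℝ) 1, (u - ε • gegOp l u).eval t ≤ M) {t : ℝ}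
    (ht : t ∈ Icc (-1 : ℝ) 1) : u.eval t ≤ M := by
  obtain ⟨t₀, ht₀, hmax⟩ := isCompact_Icc.exists_isMaxOn (f := fun x => u.eval x) ⟨t, ht⟩
    (by fun_prop)
  -- At a maximum of `u`, subtracting `ε • gegOp l u` can only raise the value.
  have h1 := eval_gegOp_nonpos_of_isMaxOn hl u ht₀ hmax
  have h2 := h t₀ ht₀
  simp only [eval_sub, eval_smul, smul_eq_mul] at h2
  have h3 : u.eval t ≤ u.eval t₀ := hmax ht
  nlinarith

theorem abs_eval_le_of_resolvent_le {l : ℝ} (hl : 0 ≤ l) {ε : ℝ} (hε : 0 ≤ ε) (u : ℝ[X]) {M : ℝ}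
    (h : ∀ t ∈ Icc (-1 : ℝ) 1, |(u - ε • gegOp l u).eval t| ≤ M) {t : ℝ}
    (ht : t ∈ Icc (-1 : ℝ) 1) : |u.eval t| ≤ M := by
  have h1 := eval_le_of_resolvent_le hl hε u (fun x hx => (abs_le.1 (h x hx)).2) ht
  have h2 := eval_le_of_resolvent_le hl hε (-u) (M := M) (fun x hx => by
    have := (abs_le.1 (h x hx)).1
    simp only [map_neg, smul_neg, eval_sub, eval_neg, eval_smul, smul_eq_mul] at this ⊢
    linarith) ht
  rw [eval_neg] at h2
  exact abs_le.2 ⟨by linarith, h1⟩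

section Multiplier

variable {l : ℝ} {P : ℕ → ℝ[X]}

/-- The resolvent of `gegOp l` is diagonal in the `P n`, dividing by `1 + ε * ultraEig l n`. The
maximum principle makes it a contraction, hence also its powers. -/
theorem abs_sum_resolvent_le (hl : 0 ≤ l) (hP : ∀ n, IsUltraspherical l n (P n)) {ε : ℝ}
    (hε : 0 ≤ ε) (s : Finset ℕ) (k : ℕ) (a : ℕ → ℝ) {M : ℝ}
    (h : ∀ t ∈ Icc (-1 : ℝ) 1, |∑ n ∈ s, a n * (P n).eval t| ≤ M) :
    ∀ t ∈ Icc (-1 : ℝ) 1,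
      |∑ n ∈ s, a n / (1 + ε * ultraEig l n) ^ k * (P n).eval t| ≤ M := by
  induction k with
  | zero => simpa using h
  | succ k ih =>
    intro t ht
    have hu := abs_eval_le_of_resolvent_le hl hε
      (∑ n ∈ s, (a n / (1 + ε * ultraEig l n) ^ (k + 1)) • P n) (M := M) ?_ ht
    · simpa [eval_finsetSum] using hu
    · intro x hx
      convert ih x hx using 2
      simp only [map_sum, map_smul, (hP _).ode, eval_sub, eval_smul, eval_finsetSum, smul_eq_mul,
        Finset.mul_sum, ← Finset.sum_sub_distrib]
      refine Finset.sum_congr rfl fun n _ => ?_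
      have : 0 < 1 + ε * ultraEig l n := by
        have := mul_nonneg hε (ultraEig_nonneg hl n)
        linarith
      field_simp
      ring

/-- The ultraspherical heat semigroup contracts the sup norm on `[-1, 1]`. -/
theorem abs_sum_heat_le (hl : 0 ≤ l) (hP : ∀ n, IsUltraspherical l n (P n)) {r : ℝ}
    (hr : 0 ≤ r) (s : Finset ℕ) (a : ℕ → ℝ) {M : ℝ}
    (h : ∀ t ∈ Icc (-1 : ℝ) 1, |∑ n ∈ s, a n * (P n).eval t| ≤ M) :
    ∀ t ∈ Icc (-1 : ℝ) 1,
      |∑ n ∈ s, a n * Real.exp (-(r * ultraEig l n)) * (P n).eval t| ≤ M := by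
  intro t ht
  -- Implicit Euler scheme: `k` resolvent steps of size `r / k` tend to the exponential factor.
  have hlim : Tendsto (fun k : ℕ =>
      |∑ n ∈ s, a n / (1 + r / k * ultraEig l n) ^ k * (P n).eval t|) atTop
      (𝓝 |∑ n ∈ s, a n * Real.exp (-(r * ultraEig l n)) * (P n).eval t|) := by
    refine (tendsto_finsetSum _ fun n _ => Tendsto.mul_const _ ?_).abs
    rw [Real.exp_neg, ← div_eq_mul_inv]
    refine Tendsto.div tendsto_const_nhds ?_ (Real.exp_ne_zero _)
    refine (Real.tendsto_one_add_div_pow_exp (r * ultraEig l n)).congr fun k => ?_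
    ring
  exact le_of_tendsto' hlim fun k =>
    abs_sum_resolvent_le hl hP (div_nonneg hr (Nat.cast_nonneg k)) s k a h t ht

/-- One polynomial per degree gives a basis. Any index set containing the support is allowed, so
that two expansions can share one. -/
theorem exists_eq_sum_smul (hP : ∀ n, IsUltraspherical l n (P n)) (q : ℝ[X]) :
    ∃ c : ℕ →₀ ℝ, ∀ s, c.support ⊆ s → q = ∑ n ∈ s, c n • P n := by
  have hne : ∀ n, P n ≠ 0 := fun n h => by simpa [h] using (hP n).leadingCoeff_pos
  let S : Polynomial.Sequence ℝ :=
    ⟨P, fun n => by rw [degree_eq_natDegree (hne n), (hP n).natDegree_eq]⟩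
  have hspan := S.span fun n => (hP n).leadingCoeff_pos.ne'.isUnit
  have hq : q ∈ Submodule.span ℝ (Set.range P) := by
    rw [show Submodule.span ℝ (Set.range P) = ⊤ from hspan]
    trivial
  obtain ⟨c, hc⟩ := Finsupp.mem_span_range_iff_exists_finsupp.1 hq
  exact ⟨c, fun s hs => hc.symm.trans (Finsupp.sum_of_support_subset c hs _ (by simp))⟩

end Multiplier

end SphereEnergy

/-! ### Sign of `∑ b i * f (x i)` from the signs of the expansion terms. -/

namespace SphereEnergy

open Polynomial Set Filter Topology

/-- The weighted `L²` norm squared of a polynomial. -/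
noncomputable def ultraNormSq (l : ℝ) (p : ℝ[X]) : ℝ :=
  ∫ t in (-1 : ℝ)..1, p.eval t ^ 2 * ultraWeight l t

/-- The coefficient of `f` along `p` in the weighted `L²` space. -/
noncomputable def ultraCoeff (l : ℝ) (p : ℝ[X]) (f : ℝ → ℝ) : ℝ :=
  (∫ t in (-1 : ℝ)..1, f t * p.eval t * ultraWeight l t) / ultraNormSq l p

theorem IsUltraspherical.ultraNormSq_pos {l : ℝ} (hl : 0 ≤ l) {n : ℕ} {p : ℝ[X]}
    (hp : IsUltraspherical l n p) : 0 < ultraNormSq l p := by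
  have hlc := hp.leadingCoeff_pos
  have h : 0 < (3 / 4 : ℝ) ^ (l + n) * p.leadingCoeff ^ 2 := by positivity
  exact pos_of_mul_pos_right (h.trans_le (hp.le_integral_sq hl)) (by positivity)

/-- A bound for the sup norm of `p` on `[-1, 1]` when `p` is ultraspherical of degree `n`. -/
noncomputable def ultraSup (n : ℕ) (p : ℝ[X]) : ℝ := (n + 1) * (n : ℝ) ^ n * p.leadingCoeff

theorem tendsto_mul_exp_neg_mul {r : ℝ} (hr : 0 < r) (K : ℝ) :
    Tendsto (fun n : ℕ => K * ((n + 1 : ℝ) ^ 3 * Real.exp (-(r * n)))) atTop (𝓝 0) := by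
  have hlt : |Real.exp (-r)| < 1 := by
    rw [abs_of_pos (Real.exp_pos _)]
    rw [← Real.exp_zero]
    exact Real.exp_lt_exp.2 (by linarith)
  have h := (tendsto_add_atTop_iff_nat 1).2 (tendsto_pow_const_mul_const_pow_of_abs_lt_one 3 hlt)
  have h2 := h.const_mul (K * Real.exp r)
  rw [mul_zero] at h2
  refine h2.congr fun n => ?_
  rw [← Real.exp_nat_mul, show -(r * n) = r + ((n + 1 : ℕ) : ℝ) * -r by push_cast; ring,
    Real.exp_add]
  push_cast
  ring

/-- The eigenvalue grows quadratically, so the heat factor is at most `exp (-r n) ^ n`. It beats the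
growth of the ratio, which is at most a constant times the `n`-th power of a multiple of `(n+1)³`.
-/
theorem summable_heat {l : ℝ} {P : ℕ → ℝ[X]} (hl : 0 ≤ l)
    (hP : ∀ n, IsUltraspherical l n (P n)) {r : ℝ} (hr : 0 < r) :
    Summable fun n : ℕ =>
      Real.exp (-(r * ultraEig l n)) * (ultraSup n (P n) ^ 2 / ultraNormSq l (P n)) := by
  -- The factors come from `(n+1)² ≤ 4^n`, from `2(l+n) ≤ 2(l+1)(n+1)`, and from inverting `3/4` in
  -- the norm bound.
  set K : ℝ := 4 * (2 * (l + 1)) * (4 / 3) with hK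
  have hK0 : 0 < K := by positivity
  have hgeo : Summable fun n : ℕ => (4 / 3 : ℝ) ^ l * (1 / 2 : ℝ) ^ n :=
    (summable_geometric_of_lt_one (by norm_num) (by norm_num)).mul_left _
  refine Summable.of_norm_bounded_eventually_nat hgeo ?_
  filter_upwards [(tendsto_mul_exp_neg_mul hr K).eventually_le_const (u := 1 / 2) (by norm_num)]
    with n hn
  have hN := (hP n).ultraNormSq_pos hl
  have hlc := (hP n).leadingCoeff_pos
  rw [Real.norm_of_nonneg (by positivity)]
  have hratio : (P n).leadingCoeff ^ 2 / ultraNormSq l (P n) ≤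
      (2 * (l + n)) ^ n * ((4 / 3 : ℝ) ^ l * (4 / 3) ^ n) := by
    have h := (hP n).le_integral_sq hl
    rw [div_le_iff₀ hN]
    have h43 : (4 / 3 : ℝ) ^ l * (4 / 3) ^ n * (3 / 4 : ℝ) ^ (l + n) = 1 := by
      rw [← Real.rpow_natCast, ← Real.rpow_add (by norm_num), ← Real.mul_rpow (by norm_num)
        (by norm_num)]
      norm_num
    calc (P n).leadingCoeff ^ 2
        = (4 / 3 : ℝ) ^ l * (4 / 3) ^ n * ((3 / 4 : ℝ) ^ (l + n) * (P n).leadingCoeff ^ 2) := by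
          rw [← mul_assoc, h43, one_mul]
      _ ≤ (4 / 3 : ℝ) ^ l * (4 / 3) ^ n * ((2 * (l + n)) ^ n * ultraNormSq l (P n)) := by
          exact mul_le_mul_of_nonneg_left h (by positivity)
      _ = _ := by ring
  have hexp : Real.exp (-(r * ultraEig l n)) ≤ Real.exp (-(r * n)) ^ n := by
    rw [← Real.exp_nat_mul, Real.exp_le_exp]
    unfold ultraEig
    have : 0 ≤ r * (n * (2 * l)) := by positivity
    nlinarith
  have h2n : ((n : ℝ) + 1) ^ 2 ≤ 4 ^ n := by
    have : (n : ℝ) + 1 ≤ 2 ^ n := by exact_mod_cast Nat.lt_two_pow_self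
    calc ((n : ℝ) + 1) ^ 2 ≤ (2 ^ n) ^ 2 := by gcongr
      _ = 4 ^ n := by rw [← pow_mul, mul_comm, pow_mul]; norm_num
  have hln : 2 * (l + n) ≤ 2 * (l + 1) * (n + 1) := by
    have : 0 ≤ l * n := by positivity
    nlinarith
  calc Real.exp (-(r * ultraEig l n)) * (ultraSup n (P n) ^ 2 / ultraNormSq l (P n))
      = Real.exp (-(r * ultraEig l n)) * ((n + 1 : ℝ) ^ 2 * ((n : ℝ) ^ n) ^ 2 *
          ((P n).leadingCoeff ^ 2 / ultraNormSq l (P n))) := by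
        unfold ultraSup
        ring
    _ ≤ Real.exp (-(r * n)) ^ n * (4 ^ n * (((n : ℝ) + 1) ^ n) ^ 2 *
          ((2 * (l + 1) * (n + 1)) ^ n * ((4 / 3 : ℝ) ^ l * (4 / 3) ^ n))) := by
        gcongr
        · linarith
        · refine hratio.trans ?_
          gcongr
    _ = (4 / 3 : ℝ) ^ l * (K * ((n + 1 : ℝ) ^ 3 * Real.exp (-(r * n)))) ^ n := by
        rw [hK]
        generalize (n : ℝ) + 1 = N
        generalize l + 1 = L
        simp only [mul_pow]
        ring
    _ ≤ (4 / 3 : ℝ) ^ l * (1 / 2 : ℝ) ^ n := by gcongr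

section Expansion

variable {l : ℝ} {P : ℕ → ℝ[X]}

theorem ultraCoeff_sum (hl : 0 ≤ l) (hP : ∀ n, IsUltraspherical l n (P n)) (s : Finset ℕ)
    (a : ℕ → ℝ) {m : ℕ} (hm : m ∈ s) :
    ultraCoeff l (P m) (fun t => (∑ n ∈ s, a n • P n).eval t) = a m := by
  have hN := (hP m).ultraNormSq_pos hl
  rw [ultraCoeff, div_eq_iff hN.ne']
  have e : ∀ t, (∑ n ∈ s, a n • P n).eval t * (P m).eval t * ultraWeight l t =
      ∑ n ∈ s, a n * ((P n).eval t * (P m).eval t * ultraWeight l t) := by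
    intro t
    simp only [eval_finsetSum, eval_smul, smul_eq_mul, Finset.sum_mul]
    exact Finset.sum_congr rfl fun n _ => by ring
  simp_rw [e]
  rw [intervalIntegral.integral_finsetSum fun n _ =>
    (intervalIntegrable_mul_ultraWeight hl (by fun_prop)).const_mul (a n)]
  simp_rw [intervalIntegral.integral_const_mul]
  rw [Finset.sum_eq_single_of_mem m hm fun n _ hn => by
    rw [(hP n).orthogonal hl hn (hP m), mul_zero]]
  simp [ultraNormSq, sq]

theorem abs_ultraCoeff_sub_le (hl : 0 ≤ l) (hP : ∀ n, IsUltraspherical l n (P n)) {f g : ℝ → ℝ}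
    (hf : ContinuousOn f (Icc (-1) 1)) (hg : ContinuousOn g (Icc (-1) 1)) {η : ℝ}
    (h : ∀ t ∈ Icc (-1 : ℝ) 1, |g t - f t| ≤ η) (n : ℕ) :
    |ultraCoeff l (P n) g - ultraCoeff l (P n) f| ≤
      η * (ultraSup n (P n) / ultraNormSq l (P n)) * ∫ t in (-1 : ℝ)..1, ultraWeight l t := by
  have hN := (hP n).ultraNormSq_pos hl
  have hη : 0 ≤ η := (abs_nonneg _).trans (h 0 (by norm_num))
  have hgi := intervalIntegrable_mul_ultraWeight hl
    (g := fun t => g t * (P n).eval t) (hg.mul (by fun_prop))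
  have hfi := intervalIntegrable_mul_ultraWeight hl
    (g := fun t => f t * (P n).eval t) (hf.mul (by fun_prop))
  rw [ultraCoeff, ultraCoeff, ← sub_div, abs_div, abs_of_pos hN, div_le_iff₀ hN,
    ← intervalIntegral.integral_sub hgi hfi, ← Real.norm_eq_abs]
  refine (intervalIntegral.norm_integral_le_of_norm_le
    (g := fun t => η * ultraSup n (P n) * ultraWeight l t) (by norm_num)
    (ae_of_all _ fun t ht => ?_) ((intervalIntegrable_ultraWeight hl).const_mul _)).trans_eq ?_
  · have ht' : t ∈ Icc (-1 : ℝ) 1 := ⟨ht.1.le, ht.2⟩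
    rw [← sub_mul, ← sub_mul, norm_mul, norm_mul, Real.norm_of_nonneg (ultraWeight_nonneg l ht')]
    have hw := ultraWeight_nonneg l ht'
    have := (hP n).abs_eval_le hl ht'
    gcongr
    · exact h t ht'
    · exact this
  · rw [intervalIntegral.integral_const_mul]
    field_simp

/-- Were the series to converge, summing the hypothesis over `n` would suffice. Instead, a
polynomial `q` close to `f` is smoothed by the heat semigroup. Its coefficients differ slightly from
those of `f`, and the heat factors make the total error summable. A coarser approximant `q₀` fixes
the heat time before the accuracy of `q` is chosen; contraction then compares the two smoothed
polynomials. -/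
theorem sum_mul_nonpos_of_ultraCoeff (hl : 0 ≤ l) (hP : ∀ n, IsUltraspherical l n (P n))
    {f : ℝ → ℝ} (hf : ContinuousOn f (Icc (-1) 1)) {ι : Type*} (u : Finset ι) (b x : ι → ℝ)
    (hx : ∀ i ∈ u, x i ∈ Icc (-1 : ℝ) 1)
    (h : ∀ n, ultraCoeff l (P n) f * ∑ i ∈ u, b i * (P n).eval (x i) ≤ 0) :
    ∑ i ∈ u, b i * f (x i) ≤ 0 := by
  set B := ∑ i ∈ u, |b i| with hB
  have hB0 : 0 ≤ B := Finset.sum_nonneg fun i _ => abs_nonneg _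
  set W := ∫ t in (-1 : ℝ)..1, ultraWeight l t with hW
  have hW0 : 0 ≤ W := intervalIntegral.integral_nonneg (by norm_num)
    fun t ht => ultraWeight_nonneg l ht
  have hBd : ∀ (g : ℝ → ℝ) (M : ℝ), (∀ t ∈ Icc (-1 : ℝ) 1, |g t| ≤ M) →
      |∑ i ∈ u, b i * g (x i)| ≤ B * M := by
    intro g M hg
    refine (Finset.abs_sum_le_sum_abs _ _).trans ?_
    rw [hB, Finset.sum_mul]
    refine Finset.sum_le_sum fun i hi => ?_
    rw [abs_mul]
    exact mul_le_mul_of_nonneg_left (hg _ (hx i hi)) (abs_nonneg _)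
  -- Error budget: `B η` from `f` to `q₀`, `η` for smoothing `q₀`, `2 B η` between the smoothed `q₀`
  -- and `q`, and `η` for the smoothed `q`.
  suffices H : ∀ η > 0, ∑ i ∈ u, b i * f (x i) ≤ η * (3 * B + 2) by
    refine le_of_forall_pos_le_add fun ε hε => ?_
    have := H (ε / (3 * B + 2)) (by positivity)
    rwa [div_mul_cancel₀ _ (by positivity), ← zero_add ε] at this
  intro η hη
  obtain ⟨q₀, hq₀⟩ := exists_polynomial_near_of_continuousOn (-1) 1 f hf η hη
  obtain ⟨c₀, hc₀⟩ := exists_eq_sum_smul hP q₀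
  let heat : ℝ → Finset ℕ → (ℕ → ℝ) → ℝ → ℝ := fun r s a t =>
    ∑ n ∈ s, a n * Real.exp (-(r * ultraEig l n)) * (P n).eval t
  have hq₀eval : ∀ s, c₀.support ⊆ s → ∀ t, q₀.eval t = ∑ n ∈ s, c₀ n * (P n).eval t := by
    intro s hs t
    rw [hc₀ s hs]
    simp [eval_finsetSum]
  obtain ⟨r, hr₁, hr⟩ : ∃ r : ℝ,
      ∑ i ∈ u, b i * (q₀.eval (x i) - heat r c₀.support c₀ (x i)) ≤ η ∧ 0 < r := by
    have hc : Continuous fun r : ℝ =>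
        ∑ i ∈ u, b i * (q₀.eval (x i) - heat r c₀.support c₀ (x i)) := by
      simp only [heat]
      fun_prop
    have h0 : ∑ i ∈ u, b i * (q₀.eval (x i) - heat 0 c₀.support c₀ (x i)) = 0 := by
      refine Finset.sum_eq_zero fun i _ => ?_
      rw [hq₀eval _ subset_rfl]
      simp [heat]
    have h1 := (hc.tendsto' 0 0 h0).eventually_le_const hη
    exact ((h1.filter_mono nhdsWithin_le_nhds).and
      (self_mem_nhdsWithin : Ioi (0 : ℝ) ∈ 𝓝[>] 0)).exists
  have hsum := summable_heat hl hP hr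
  set S := ∑' n : ℕ,
    Real.exp (-(r * ultraEig l n)) * (ultraSup n (P n) ^ 2 / ultraNormSq l (P n)) with hS
  have hterm : ∀ n : ℕ, 0 ≤
      Real.exp (-(r * ultraEig l n)) * (ultraSup n (P n) ^ 2 / ultraNormSq l (P n)) := fun n => by
    have := (hP n).ultraNormSq_pos hl
    positivity
  have hS0 : 0 ≤ S := tsum_nonneg hterm
  -- This makes `δ * (B * W * S) ≤ η`; the `1` keeps the denominator positive. `S` depends on `r`,
  -- so `δ` is chosen after `r`.
  set δ := min η (η / (B * W * S + 1)) with hδ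
  have hδ0 : 0 < δ := by positivity
  obtain ⟨q, hq⟩ := exists_polynomial_near_of_continuousOn (-1) 1 f hf δ hδ0
  obtain ⟨c, hc⟩ := exists_eq_sum_smul hP q
  set s := c₀.support ∪ c.support with hs
  have hheat₀ : ∀ t, heat r c₀.support c₀ t = heat r s c₀ t := by
    intro t
    refine Finset.sum_subset Finset.subset_union_left fun n _ hn => ?_
    rw [Finsupp.notMem_support_iff.1 hn]
    ring
  have hqs := hc s Finset.subset_union_right
  have hq₀s := hq₀eval s Finset.subset_union_left
  have hqeval : ∀ t, q.eval t = ∑ n ∈ s, c n * (P n).eval t := by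
    intro t
    rw [hqs]
    simp [eval_finsetSum]
  have hcoef : ∀ n ∈ s, ultraCoeff l (P n) (fun t => q.eval t) = c n := by
    intro n hn
    rw [hqs]
    exact ultraCoeff_sum hl hP s c hn
  have hdiff : ∀ t ∈ Icc (-1 : ℝ) 1, |heat r s c₀ t - heat r s c t| ≤ 2 * η := by
    intro t ht
    have := abs_sum_heat_le hl hP hr.le s (fun n => c₀ n - c n) (M := 2 * η) ?_ t ht
    · simpa only [heat, ← Finset.sum_sub_distrib, ← sub_mul] using this
    · intro y hy
      simp only [sub_mul, Finset.sum_sub_distrib]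
      rw [← hq₀s, ← hqeval]
      have h1 := abs_lt.1 (hq₀ y hy)
      have h2 := abs_lt.1 (hq y hy)
      have h3 : δ ≤ η := min_le_left _ _
      rw [abs_le]
      constructor <;> linarith [h1.1, h1.2, h2.1, h2.2]
  have hmain : ∑ i ∈ u, b i * heat r s c (x i) ≤ η := by
    have e1 : ∑ i ∈ u, b i * heat r s c (x i) =
        ∑ n ∈ s, Real.exp (-(r * ultraEig l n)) * (c n * ∑ i ∈ u, b i * (P n).eval (x i)) := by
      simp only [heat, Finset.mul_sum]
      rw [Finset.sum_comm]
      exact Finset.sum_congr rfl fun n _ => Finset.sum_congr rfl fun i _ => by ring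
    rw [e1]
    calc ∑ n ∈ s, Real.exp (-(r * ultraEig l n)) * (c n * ∑ i ∈ u, b i * (P n).eval (x i))
        ≤ ∑ n ∈ s, δ * W * B * (Real.exp (-(r * ultraEig l n)) *
            (ultraSup n (P n) ^ 2 / ultraNormSq l (P n))) := by
          refine Finset.sum_le_sum fun n hn => ?_
          set T := ∑ i ∈ u, b i * (P n).eval (x i) with hT
          have hT1 : |T| ≤ B * ultraSup n (P n) :=
            hBd (fun t => (P n).eval t) _ fun t ht => (hP n).abs_eval_le hl ht
          have hc1 := abs_ultraCoeff_sub_le hl hP hf (g := fun t => q.eval t) (by fun_prop)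
            (fun t ht => (hq t ht).le) n
          rw [hcoef n hn] at hc1
          -- The part of `c n * T` with the true coefficient of `f` is nonpositive by hypothesis,
          -- leaving the coefficient error.
          have h1 : c n * T ≤ |c n - ultraCoeff l (P n) f| * |T| := by
            rw [← abs_mul]
            refine le_trans ?_ (le_abs_self _)
            linarith [h n]
          have h2 : c n * T ≤ δ * (ultraSup n (P n) / ultraNormSq l (P n)) * W *
              (B * ultraSup n (P n)) :=
            h1.trans (mul_le_mul hc1 hT1 (abs_nonneg _) ((abs_nonneg _).trans hc1))
          calc _ ≤ Real.exp (-(r * ultraEig l n)) *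
              (δ * (ultraSup n (P n) / ultraNormSq l (P n)) * W * (B * ultraSup n (P n))) := by
                gcongr
            _ = _ := by ring
      _ = δ * W * B * ∑ n ∈ s, (Real.exp (-(r * ultraEig l n)) *
            (ultraSup n (P n) ^ 2 / ultraNormSq l (P n))) := (Finset.mul_sum _ _ _).symm
      _ ≤ δ * W * B * S := by
          gcongr
          exact hsum.sum_le_tsum s fun n _ => hterm n
      _ = δ * (B * W * S) := by ring
      _ ≤ δ * (B * W * S + 1) := by gcongr; linarith
      _ ≤ η / (B * W * S + 1) * (B * W * S + 1) := by
          gcongr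
          exact min_le_right _ _
      _ = η := div_mul_cancel₀ _ (by positivity)
  have h1 := (abs_le.1 (hBd (fun t => q₀.eval t - f t) η fun t ht => (hq₀ t ht).le)).1
  have h2 := (abs_le.1 (hBd (fun t => heat r s c₀ t - heat r s c t) (2 * η) hdiff)).2
  simp only [mul_sub, Finset.sum_sub_distrib, hheat₀] at h1 h2 hr₁
  linarith

end Expansion

end SphereEnergy

/-! ### Gegenbauer and Chebyshev polynomials are ultraspherical. -/

namespace SphereEnergy

open Polynomial Set Filter Topology

theorem IsUltraspherical.C_mul {l : ℝ} {n : ℕ} {p : ℝ[X]} (hp : IsUltraspherical l n p) {c : ℝ}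
    (hc : 0 < c) : IsUltraspherical l n (C c * p) := by
  refine ⟨by rw [natDegree_C_mul hc.ne', hp.natDegree_eq], ?_, ?_⟩
  · rw [leadingCoeff_mul, leadingCoeff_C]
    exact mul_pos hc hp.leadingCoeff_pos
  · rw [← smul_eq_C_mul, map_smul, hp.ode, smul_comm]

/-- The coefficient of `(2t)^(n - 2k)` in the Gegenbauer polynomial. -/
noncomputable def gegenbauerCoeff (l : ℝ) (n k : ℕ) : ℝ :=
  (-1) ^ k * (ascPochhammer ℝ (n - k)).eval l
    / ((Nat.factorial k : ℝ) * (Nat.factorial (n - 2 * k) : ℝ))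

theorem coeff_gegenbauer (l : ℝ) (n m : ℕ) :
    (gegenbauer l n).coeff m =
      ∑ k ∈ Finset.range (n / 2 + 1),
        if m = n - 2 * k then gegenbauerCoeff l n k * 2 ^ m else 0 := by
  rw [gegenbauer, finsetSum_coeff]
  refine Finset.sum_congr rfl fun k _ => ?_
  rw [coeff_C_mul, mul_pow, ← C_ofNat, ← C_pow, coeff_C_mul, coeff_X_pow, gegenbauerCoeff]
  split_ifs with h <;> simp [h]

theorem coeff_gegenbauer_sub (l : ℝ) {n m k : ℕ} (h : m + 2 * k = n) :
    (gegenbauer l n).coeff m = gegenbauerCoeff l n k * 2 ^ m := by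
  rw [coeff_gegenbauer, Finset.sum_eq_single_of_mem k (Finset.mem_range.2 (by lia))]
  · rw [if_pos (by lia)]
  · intro j hj hjk
    rw [Finset.mem_range] at hj
    rw [if_neg (by lia)]

theorem coeff_gegenbauer_eq_zero (l : ℝ) {n m : ℕ} (h : ∀ k, m + 2 * k ≠ n) :
    (gegenbauer l n).coeff m = 0 := by
  rw [coeff_gegenbauer]
  refine Finset.sum_eq_zero fun k hk => ?_
  rw [Finset.mem_range] at hk
  have := h k
  rw [if_neg (by lia)]

theorem isUltraspherical_gegenbauer {l : ℝ} (hl : 0 < l) (n : ℕ) :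
    IsUltraspherical l n (gegenbauer l n) := by
  have hpos : 0 < (gegenbauer l n).coeff n := by
    rw [coeff_gegenbauer_sub l (k := 0) (by lia), gegenbauerCoeff]
    have := ascPochhammer_pos n l hl
    simp only [pow_zero, Nat.sub_zero, mul_zero, Nat.factorial_zero, Nat.cast_one, one_mul]
    positivity
  have hdeg : (gegenbauer l n).natDegree = n := by
    refine natDegree_eq_of_le_of_coeff_ne_zero (natDegree_le_iff_coeff_eq_zero.2 fun m hm => ?_)
      hpos.ne'
    exact coeff_gegenbauer_eq_zero l fun k => by lia
  refine IsUltraspherical.of_coeff hdeg (by rwa [leadingCoeff, hdeg]) fun m => ?_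
  by_cases h : ∃ k, m + 2 * k = n
  · obtain ⟨k, hk⟩ := h
    rcases k with _ | k
    · obtain rfl : m = n := by lia
      rw [coeff_gegenbauer_eq_zero l (m := m + 2) fun k => by lia]
      simp
    · rw [coeff_gegenbauer_sub l (m := m + 2) (k := k) (by lia), coeff_gegenbauer_sub l hk]
      subst hk
      rw [gegenbauerCoeff, gegenbauerCoeff,
        show m + 2 * (k + 1) - k = (m + k + 1) + 1 by lia,
        show m + 2 * (k + 1) - 2 * k = m + 2 by lia,
        show m + 2 * (k + 1) - (k + 1) = m + k + 1 by lia,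
        show m + 2 * (k + 1) - 2 * (k + 1) = m by lia, ascPochhammer_succ_eval,
        Nat.factorial_succ (m + 1), Nat.factorial_succ m, Nat.factorial_succ k, ultraEig, ultraEig]
      have h1 := Nat.factorial_ne_zero m
      have h2 := Nat.factorial_ne_zero k
      push_cast
      field_simp
      ring
  · push Not at h
    rw [coeff_gegenbauer_eq_zero l h]
    rw [coeff_gegenbauer_eq_zero l (m := m + 2) fun k hk => h (k + 1) (by lia)]
    ring

theorem isUltraspherical_chebyshev (n : ℕ) :
    IsUltraspherical 0 n (Polynomial.Chebyshev.T ℝ n) := by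
  refine ⟨by simp, by simp, ?_⟩
  have h := Polynomial.Chebyshev.one_sub_X_sq_mul_derivative_derivative_T_eq_poly_in_T (R := ℝ) n
  simp only [Function.iterate_succ, Function.iterate_zero, Function.comp_apply, id_eq] at h
  rw [gegOp_apply, h, ultraEig, smul_eq_C_mul]
  simp only [mul_zero, add_zero, zero_add, map_one, map_neg, map_mul, map_natCast,
    Int.cast_natCast]
  ring

theorem lam_nonneg {d : ℕ} (hd : 2 ≤ d) : 0 ≤ lam d := by
  have : (2 : ℝ) ≤ d := by exact_mod_cast hd
  unfold lam
  linarith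

theorem isUltraspherical_zonal {d : ℕ} (hd : 2 ≤ d) (n : ℕ) :
    IsUltraspherical (lam d) n (zonal d n) := by
  unfold zonal
  split_ifs with h1 h2
  · subst h1 h2
    simpa [lam] using isUltraspherical_chebyshev 0
  · subst h1
    simpa [lam, C_ofNat] using (isUltraspherical_chebyshev n).C_mul (c := 2) (by norm_num)
  · have h3 : (2 : ℝ) < d := by exact_mod_cast lt_of_le_of_ne hd (Ne.symm h1)
    have hl : 0 < lam d := by
      unfold lam
      linarith
    exact (isUltraspherical_gegenbauer hl n).C_mul (by positivity)

theorem coeff_eq_ultraCoeff (d : ℕ) (f : ℝ → ℝ) (n : ℕ) :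
    coeff d f n = ultraCoeff (lam d) (zonal d n) f := rfl

end SphereEnergy

/-! ### Fischer product, zonal harmonics and Schoenberg positivity. -/

namespace SphereEnergy

section Fischer

open MvPolynomial

variable {d : ℕ}

/-- The product of the factorials of the exponents of a monomial. -/
def multiFactorial (α : Fin d →₀ ℕ) : ℝ := ∏ i, ((α i).factorial : ℝ)

/-- The Fischer inner product `∑ α! p_α q_α` on polynomials. -/
noncomputable def fischer : MvPolynomial (Fin d) ℝ →ₗ[ℝ] MvPolynomial (Fin d) ℝ →ₗ[ℝ] ℝ :=
  (basisMonomials (Fin d) ℝ).constr ℝ fun α => multiFactorial α • lcoeff ℝ α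

theorem fischer_monomial (α : Fin d →₀ ℕ) (a : ℝ) (q : MvPolynomial (Fin d) ℝ) :
    fischer (monomial α a) q = a * (multiFactorial α * MvPolynomial.coeff α q) := by
  have h : monomial α a = a • basisMonomials (Fin d) ℝ α := by
    rw [coe_basisMonomials, smul_monomial, smul_eq_mul, mul_one]
  rw [h, map_smul, fischer, Module.Basis.constr_basis]
  simp

theorem fischer_eq_sum (p q : MvPolynomial (Fin d) ℝ) :
    fischer p q =
      ∑ α ∈ p.support, p.coeff α * (multiFactorial α * q.coeff α) := by
  conv_lhs => rw [p.as_sum]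
  rw [map_sum, LinearMap.sum_apply]
  exact Finset.sum_congr rfl fun α _ => fischer_monomial _ _ _

theorem fischer_self_nonneg (p : MvPolynomial (Fin d) ℝ) : 0 ≤ fischer p p := by
  rw [fischer_eq_sum]
  refine Finset.sum_nonneg fun α _ => ?_
  have : 0 ≤ multiFactorial α := Finset.prod_nonneg fun i _ => Nat.cast_nonneg _
  nlinarith [mul_nonneg this (sq_nonneg (p.coeff α))]

theorem multiFactorial_add_single (α : Fin d →₀ ℕ) (i : Fin d) :
    multiFactorial (α + Finsupp.single i 1) = (α i + 1) * multiFactorial α := by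
  unfold multiFactorial
  rw [← Finset.mul_prod_erase _ _ (Finset.mem_univ i),
    ← Finset.mul_prod_erase _ _ (Finset.mem_univ i), ← mul_assoc]
  congr 1
  · simp [Nat.factorial_succ]
  · refine Finset.prod_congr rfl fun j hj => ?_
    simp [(Finset.ne_of_mem_erase hj).symm]

/-- Multiplication by a variable is adjoint to differentiation. -/
theorem fischer_X_mul (i : Fin d) (p q : MvPolynomial (Fin d) ℝ) :
    fischer (X i * p) q = fischer p (pderiv i q) := by
  have h : ∀ α a, fischer (X i * monomial α a) q = fischer (monomial α a) (pderiv i q) := by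
    intro α a
    rw [show (X i : MvPolynomial (Fin d) ℝ) = monomial (Finsupp.single i 1) 1 from rfl,
      monomial_mul, fischer_monomial, fischer_monomial, coeff_pderiv,
      add_comm (Finsupp.single i 1), multiFactorial_add_single]
    ring
  rw [p.as_sum, Finset.mul_sum, map_sum, map_sum, LinearMap.sum_apply, LinearMap.sum_apply]
  exact Finset.sum_congr rfl fun α _ => h α _

/-- The squared norm as a polynomial. -/
noncomputable def normSqPoly (d : ℕ) : MvPolynomial (Fin d) ℝ := ∑ i, X i ^ 2

/-- The linear form `⟨x, ·⟩` as a polynomial. -/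
noncomputable def linearPoly (x : Fin d → ℝ) : MvPolynomial (Fin d) ℝ := ∑ i, C (x i) * X i

theorem polyLaplacian_apply (p : MvPolynomial (Fin d) ℝ) :
    polyLaplacian d p = ∑ i, pderiv i (pderiv i p) := by
  simp [polyLaplacian]

/-- Consequently multiples of the squared norm are Fischer-orthogonal to harmonic polynomials. -/
theorem fischer_normSqPoly_mul (p q : MvPolynomial (Fin d) ℝ) :
    fischer (normSqPoly d * p) q = fischer p (polyLaplacian d q) := by
  rw [normSqPoly, Finset.sum_mul, map_sum, LinearMap.sum_apply, polyLaplacian_apply, map_sum]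
  refine Finset.sum_congr rfl fun i _ => ?_
  rw [sq, mul_assoc, fischer_X_mul, fischer_X_mul]

theorem fischer_linearPoly_mul (x : Fin d → ℝ) (p q : MvPolynomial (Fin d) ℝ) :
    fischer (linearPoly x * p) q = fischer p (∑ i, C (x i) * pderiv i q) := by
  rw [linearPoly, Finset.sum_mul, map_sum, LinearMap.sum_apply, map_sum]
  refine Finset.sum_congr rfl fun i _ => ?_
  rw [mul_assoc, C_mul', C_mul', map_smul, map_smul, LinearMap.smul_apply, fischer_X_mul]

/-- The Fischer product with a power of a linear form is evaluation. -/
theorem fischer_linearPoly_pow (x : Fin d → ℝ) (n : ℕ) (h : MvPolynomial (Fin d) ℝ)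
    (hh : h.IsHomogeneous n) :
    fischer (linearPoly x ^ n) h = n.factorial * eval x h := by
  induction n generalizing h with
  | zero =>
    obtain ⟨c, rfl⟩ : ∃ c, h = C c := ⟨_, (totalDegree_eq_zero_iff_eq_C.1
      ((totalDegree_zero_iff_isHomogeneous _).2 hh))⟩
    rw [pow_zero, show (1 : MvPolynomial (Fin d) ℝ) = monomial 0 1 from rfl, fischer_monomial]
    simp [multiFactorial]
  | succ n ih =>
    rw [pow_succ', fischer_linearPoly_mul, map_sum]
    -- Euler's identity for homogeneous polynomials.
    have he := congr_arg (eval x) hh.sum_X_mul_pderiv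
    simp only [map_sum, map_mul, eval_X, map_nsmul] at he
    have hi : ∀ i, fischer (linearPoly x ^ n) (C (x i) * pderiv i h)
        = n.factorial * (x i * eval x (pderiv i h)) := by
      intro i
      rw [C_mul', map_smul, ih _ hh.pderiv, smul_eq_mul]
      ring
    simp_rw [hi]
    rw [← Finset.mul_sum, he, Nat.factorial_succ]
    simp
    ring

theorem pderiv_linearPoly (x : Fin d → ℝ) (i : Fin d) : pderiv i (linearPoly x) = C (x i) := by
  simp [linearPoly, pderiv_X, Pi.single_apply]

theorem pderiv_normSqPoly (i : Fin d) : pderiv i (normSqPoly d) = 2 * X i := by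
  simp [normSqPoly, pderiv_X, Pi.single_apply]

theorem isHomogeneous_linearPoly (x : Fin d → ℝ) : (linearPoly x).IsHomogeneous 1 :=
  IsHomogeneous.sum _ _ _ fun _ _ => isHomogeneous_C_mul_X _ _

theorem isHomogeneous_normSqPoly : (normSqPoly d).IsHomogeneous 2 :=
  IsHomogeneous.sum _ _ _ fun _ _ => isHomogeneous_X_pow _ _

/-- The product rule, with `∑ x i ^ 2 = 1` for the gradient of the linear form. Truncated
subtractions are harmless, since the factor in front then vanishes. -/
theorem polyLaplacian_linearPoly_pow_mul {x : Fin d → ℝ} (hx : ∑ i, x i ^ 2 = 1) (m k : ℕ) :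
    polyLaplacian d (linearPoly x ^ m * normSqPoly d ^ k) =
      C ((m : ℝ) * (m - 1 : ℕ)) * (linearPoly x ^ (m - 2) * normSqPoly d ^ k) +
      C ((k : ℝ) * (4 * m + 4 * (k - 1 : ℕ) + 2 * d)) *
        (linearPoly x ^ m * normSqPoly d ^ (k - 1)) := by
  set L := linearPoly x with hL
  set N := normSqPoly d with hN
  have h2 : ∀ i, pderiv i (pderiv i (L ^ m * N ^ k)) =
      C ((m : ℝ) * (m - 1 : ℕ)) * (L ^ (m - 2) * N ^ k) * C (x i ^ 2) +
      C ((k : ℝ) * 4) * (((m : MvPolynomial (Fin d) ℝ) * L ^ (m - 1)) * N ^ (k - 1)) * (C (x i) * X i) +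
      C ((k : ℝ) * 4) * (L ^ m * (((k - 1 : ℕ) : MvPolynomial (Fin d) ℝ) * N ^ (k - 2))) * X i ^ 2 +
      C ((k : ℝ) * 2) * (L ^ m * N ^ (k - 1)) := by
    intro i
    simp only [pderiv_mul, pderiv_pow, pderiv_C, pderiv_X_self, map_add, hL, hN,
      pderiv_linearPoly, pderiv_normSqPoly, Derivation.map_natCast, Nat.sub_sub]
    have : pderiv i (2 : MvPolynomial (Fin d) ℝ) = 0 := by
      exact_mod_cast (pderiv i).map_natCast 2
    rw [this]
    simp only [map_mul, map_pow, map_natCast, map_ofNat]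
    ring
  rw [polyLaplacian_apply]
  simp_rw [h2]
  rw [Finset.sum_add_distrib, Finset.sum_add_distrib, Finset.sum_add_distrib, ← Finset.mul_sum,
    ← Finset.mul_sum, ← Finset.mul_sum, ← map_sum, hx, Finset.sum_const, Finset.card_univ,
    Fintype.card_fin, nsmul_eq_mul]
  have e1 : ∑ i, C (x i) * X i = L := rfl
  have e2 : ∑ i, X i ^ 2 = N := rfl
  have e3 : (m : MvPolynomial (Fin d) ℝ) * L ^ (m - 1) * L = m * L ^ m := by
    rcases m with _ | m
    · simp
    · simp only [Nat.add_sub_cancel, pow_succ, mul_assoc]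
  have e4 : ((k - 1 : ℕ) : MvPolynomial (Fin d) ℝ) * N ^ (k - 2) * N
      = ((k - 1 : ℕ) : MvPolynomial (Fin d) ℝ) * N ^ (k - 1) := by
    rcases k with _ | _ | k
    · simp
    · simp
    · simp only [show k + 1 + 1 - 2 = k by lia,
        show k + 1 + 1 - 1 = k + 1 by lia, pow_succ, mul_assoc]
  rw [e1, e2]
  simp only [map_mul, map_natCast, map_add, map_ofNat, map_one]
  linear_combination 4 * (k : MvPolynomial (Fin d) ℝ) * N ^ (k - 1) * e3 + 4 * k * L ^ m * e4

/-- The harmonic polynomial whose restriction to the sphere is `y ↦ p(⟨x, y⟩)`. -/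
noncomputable def zonalPoly (p : Polynomial ℝ) (n : ℕ) (x : Fin d → ℝ) :
    MvPolynomial (Fin d) ℝ :=
  ∑ k ∈ Finset.range (n / 2 + 1),
    p.coeff (n - 2 * k) • (linearPoly x ^ (n - 2 * k) * normSqPoly d ^ k)

theorem isHomogeneous_zonalPoly (p : Polynomial ℝ) (n : ℕ) (x : Fin d → ℝ) :
    (zonalPoly p n x).IsHomogeneous n := by
  refine IsHomogeneous.sum _ _ _ fun k hk => ?_
  rw [Finset.mem_range] at hk
  rw [smul_eq_C_mul]
  refine IsHomogeneous.C_mul ?_ _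
  convert ((isHomogeneous_linearPoly x).pow (n - 2 * k)).mul (isHomogeneous_normSqPoly.pow k)
    using 1
  lia

/-- With `λ = (d-2)/2`, cancellation of neighbouring terms in the Laplacian is exactly the
coefficient recurrence. -/
theorem polyLaplacian_zonalPoly {n : ℕ} {p : Polynomial ℝ}
    (hp : IsUltraspherical (lam d) n p) {x : Fin d → ℝ} (hx : ∑ i, x i ^ 2 = 1) :
    polyLaplacian d (zonalPoly p n x) = 0 := by
  have key : ∀ k, polyLaplacian d
      (p.coeff (n - 2 * k) • (linearPoly x ^ (n - 2 * k) * normSqPoly d ^ k)) =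
      (p.coeff (n - 2 * k) * (((n - 2 * k : ℕ) : ℝ) * (n - 2 * k - 1 : ℕ))) •
        (linearPoly x ^ (n - 2 * k - 2) * normSqPoly d ^ k) +
      (p.coeff (n - 2 * k) * ((k : ℝ) * (4 * (n - 2 * k : ℕ) + 4 * (k - 1 : ℕ) + 2 * d))) •
        (linearPoly x ^ (n - 2 * k) * normSqPoly d ^ (k - 1)) := by
    intro k
    rw [map_smul, polyLaplacian_linearPoly_pow_mul hx, smul_add, C_mul', C_mul', smul_smul,
      smul_smul]
  rw [zonalPoly, map_sum]
  simp_rw [key]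
  -- The two sums are offset by one: the last term of the first has linear degree at most one and
  -- the first term of the second has `k = 0`, so both vanish.
  rw [Finset.sum_add_distrib, Finset.sum_range_succ, Finset.sum_range_succ']
  have h1 : ((n - 2 * (n / 2) : ℕ) : ℝ) * (n - 2 * (n / 2) - 1 : ℕ) = 0 := by
    rcases Nat.mod_two_eq_zero_or_one n with h | h
    · rw [show n - 2 * (n / 2) = 0 by lia]
      simp
    · rw [show n - 2 * (n / 2) = 1 by lia]
      simp
  rw [h1]
  simp only [mul_zero, zero_smul, add_zero, Nat.cast_zero, zero_mul]
  rw [← Finset.sum_add_distrib]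
  refine Finset.sum_eq_zero fun k hk => ?_
  rw [Finset.mem_range] at hk
  obtain ⟨m, hm⟩ : ∃ m, n = m + 2 * (k + 1) := ⟨n - 2 * (k + 1), by lia⟩
  rw [show n - 2 * k = m + 2 by lia, show n - 2 * (k + 1) = m by lia,
    show m + 2 - 2 = m by lia, show m + 2 - 1 = m + 1 by lia, Nat.add_sub_cancel, ← add_smul]
  have hr := hp.coeff_rec m
  have hz : p.coeff (m + 2) * (((m + 2 : ℕ) : ℝ) * (m + 1 : ℕ)) +
      p.coeff m * (((k + 1 : ℕ) : ℝ) * (4 * m + 4 * k + 2 * d)) = 0 := by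
    rw [ultraEig, ultraEig, hm, lam] at hr
    push_cast at hr ⊢
    linear_combination hr
  rw [hz, zero_smul]

/-- Against a harmonic polynomial only the power of the linear form survives, and that power
evaluates. -/
theorem exists_zonalPoly_eq (p : Polynomial ℝ) (n : ℕ) (x : Fin d → ℝ) :
    ∃ g, zonalPoly p n x = p.coeff n • linearPoly x ^ n + normSqPoly d * g := by
  refine ⟨∑ k ∈ Finset.range (n / 2), p.coeff (n - 2 * (k + 1)) •
    (linearPoly x ^ (n - 2 * (k + 1)) * normSqPoly d ^ k), ?_⟩
  rw [zonalPoly, Finset.sum_range_succ', add_comm, Finset.mul_sum]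
  congr 1
  · simp
  · refine Finset.sum_congr rfl fun k _ => ?_
    rw [pow_succ, mul_smul_comm]
    congr 1
    ring

/-- The squared norm is `1` on the sphere, and by parity the coefficients omitted from `zonalPoly`
are zero. -/
theorem eval_zonalPoly {l : ℝ} (hl : 0 ≤ l) {n : ℕ} {p : Polynomial ℝ}
    (hp : IsUltraspherical l n p) (x : Fin d → ℝ) {y : Fin d → ℝ} (hy : ∑ i, y i ^ 2 = 1) :
    eval y (zonalPoly p n x) = p.eval (∑ i, x i * y i) := by
  have h1 : eval y (linearPoly x) = ∑ i, x i * y i := by simp [linearPoly]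
  have h2 : eval y (normSqPoly d) = 1 := by simp [normSqPoly, hy]
  simp only [zonalPoly, map_sum, smul_eval, map_mul, map_pow, h1, h2, one_pow, mul_one]
  rw [Polynomial.eval_eq_sum_range, hp.natDegree_eq]
  generalize ∑ i, x i * y i = t
  have hinj : Set.InjOn (fun k => n - 2 * k) (Finset.range (n / 2 + 1)) := by
    intro a ha b hb hab
    simp only [Finset.coe_range, Set.mem_Iio] at ha hb hab
    lia
  rw [← Finset.sum_image (f := fun m => p.coeff m * t ^ m) hinj]
  refine Finset.sum_subset ?_ fun m hm hm' => ?_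
  · intro m hm
    obtain ⟨k, -, rfl⟩ := Finset.mem_image.1 hm
    rw [Finset.mem_range]
    lia
  · rw [Finset.mem_range] at hm
    have hodd : (n - m) % 2 = 1 := by
      by_contra hcon
      exact hm' (Finset.mem_image.2 ⟨(n - m) / 2, Finset.mem_range.2 (by lia), by lia⟩)
    rw [hp.coeff_eq_zero_of_odd hl ((n - m) / 2) m (by lia), zero_mul]

theorem sum_sphere_sq (x : Sphere d) :
    ∑ i, (x : EuclideanSpace ℝ (Fin d)) i ^ 2 = 1 := by
  have h := EuclideanSpace.norm_sq_eq (x : EuclideanSpace ℝ (Fin d))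
  rw [norm_eq_of_mem_sphere x] at h
  simpa using h.symm

theorem inner_eq_sum_mul (x y : EuclideanSpace ℝ (Fin d)) : inner ℝ x y = ∑ i, x i * y i := by
  simp [PiLp.inner_apply, mul_comm]

theorem eval_inner_eq_eval_zonalPoly (hd : 2 ≤ d) {n : ℕ} {p : Polynomial ℝ}
    (hp : IsUltraspherical (lam d) n p) (x y : Sphere d) :
    p.eval (inner ℝ (x : EuclideanSpace ℝ (Fin d)) (y : EuclideanSpace ℝ (Fin d))) =
      eval (fun i => (y : EuclideanSpace ℝ (Fin d)) i)
        (zonalPoly p n fun i => (x : EuclideanSpace ℝ (Fin d)) i) := by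
  rw [eval_zonalPoly (lam_nonneg hd) hp _ (sum_sphere_sq y), inner_eq_sum_mul]

/-- Zonal functions are spherical harmonics. -/
theorem zonal_mem_sphericalHarmonics (hd : 2 ≤ d) {n : ℕ} {p : Polynomial ℝ}
    (hp : IsUltraspherical (lam d) n p) (x : Sphere d) :
    (fun y : Sphere d => p.eval (inner ℝ (x : EuclideanSpace ℝ (Fin d))
      (y : EuclideanSpace ℝ (Fin d)))) ∈ sphericalHarmonics d n := by
  refine ⟨zonalPoly p n fun i => (x : EuclideanSpace ℝ (Fin d)) i,
    ⟨isHomogeneous_zonalPoly p n _, polyLaplacian_zonalPoly hp (sum_sphere_sq x)⟩, ?_⟩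
  ext y
  exact (eval_inner_eq_eval_zonalPoly hd hp x y).symm

/-- Schoenberg: ultraspherical polynomials give positive semidefinite kernels on the sphere. -/
theorem sum_sum_eval_inner_nonneg (hd : 2 ≤ d) {n : ℕ} {p : Polynomial ℝ}
    (hp : IsUltraspherical (lam d) n p) (S : Finset (Sphere d)) (c : Sphere d → ℝ) :
    0 ≤ ∑ x ∈ S, ∑ y ∈ S, c x * c y * p.eval (inner ℝ (x : EuclideanSpace ℝ (Fin d))
      (y : EuclideanSpace ℝ (Fin d))) := by
  set Z : Sphere d → MvPolynomial (Fin d) ℝ :=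
    fun x => zonalPoly p n fun i => (x : EuclideanSpace ℝ (Fin d)) i with hZ
  set h := ∑ x ∈ S, c x • Z x with hh
  have hhom : h.IsHomogeneous n := IsHomogeneous.sum _ _ _ fun x _ => by
    rw [smul_eq_C_mul]
    exact (isHomogeneous_zonalPoly p n _).C_mul _
  have hharm : polyLaplacian d h = 0 := by
    rw [hh, map_sum]
    refine Finset.sum_eq_zero fun x _ => ?_
    rw [map_smul, hZ, polyLaplacian_zonalPoly hp (sum_sphere_sq x), smul_zero]
  -- Reproducing property: pairing `h` with `Z y` gives a positive multiple of `h(y)`. Hence the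
  -- double sum is a positive multiple of `fischer h h`.
  have hrep : ∀ y : Sphere d, fischer (Z y) h = p.coeff n * (n.factorial *
      ∑ x ∈ S, c x * p.eval (inner ℝ (x : EuclideanSpace ℝ (Fin d))
        (y : EuclideanSpace ℝ (Fin d)))) := by
    intro y
    obtain ⟨g, hg⟩ := exists_zonalPoly_eq p n fun i => (y : EuclideanSpace ℝ (Fin d)) i
    simp only [hZ]
    rw [hg, map_add, LinearMap.add_apply, map_smul, LinearMap.smul_apply,
      fischer_linearPoly_pow _ _ _ hhom, fischer_normSqPoly_mul, hharm, map_zero, add_zero,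
      smul_eq_mul, hh, map_sum]
    simp only [smul_eval, hZ, eval_inner_eq_eval_zonalPoly hd hp]
  have hnn := fischer_self_nonneg h
  have hexp : fischer h h = p.coeff n * n.factorial * ∑ x ∈ S, ∑ y ∈ S, c x * c y *
      p.eval (inner ℝ (x : EuclideanSpace ℝ (Fin d)) (y : EuclideanSpace ℝ (Fin d))) := by
    have hlin : ∀ q, fischer h q = ∑ x ∈ S, c x * fischer (Z x) q := by
      intro q
      rw [hh, map_sum, LinearMap.sum_apply]
      simp only [map_smul, LinearMap.smul_apply, smul_eq_mul]
    rw [hlin]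
    simp only [hrep]
    rw [Finset.sum_comm, Finset.mul_sum]
    refine Finset.sum_congr rfl fun y _ => ?_
    simp only [Finset.mul_sum]
    exact Finset.sum_congr rfl fun x _ => by ring
  rw [hexp] at hnn
  have hc : 0 < p.coeff n * n.factorial := by
    rw [hp.coeff_self]
    have := hp.leadingCoeff_pos
    positivity
  exact nonneg_of_mul_nonneg_right hnn hc

end Fischer

end SphereEnergy

/-! ### Finite configurations: support reduction and compactness. -/

namespace SphereEnergy

open Set Filter Topology

section FiniteEnergy

variable {α : Type*}

/-- The energy of a finite weighted configuration with respect to the kernel `K`. -/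
def finEnergy (K : α → α → ℝ) (S : Finset α) (w : α → ℝ) : ℝ :=
  ∑ x ∈ S, w x * ∑ y ∈ S, w y * K x y

/-- `w` is a probability weight on `S`. -/
def IsProbWeight (S : Finset α) (w : α → ℝ) : Prop :=
  (∀ x ∈ S, 0 ≤ w x) ∧ ∑ x ∈ S, w x = 1

theorem finEnergy_add_mul {K : α → α → ℝ} (hK : ∀ x y, K x y = K y x) (S : Finset α)
    (w c : α → ℝ) (t : ℝ) :
    finEnergy K S (fun x => w x + t * c x) =
      finEnergy K S w + 2 * t * (∑ x ∈ S, w x * ∑ y ∈ S, c y * K x y) +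
        t ^ 2 * finEnergy K S c := by
  have hsymm : ∑ x ∈ S, c x * ∑ y ∈ S, w y * K x y = ∑ x ∈ S, w x * ∑ y ∈ S, c y * K x y := by
    simp only [Finset.mul_sum]
    rw [Finset.sum_comm]
    refine Finset.sum_congr rfl fun x _ => Finset.sum_congr rfl fun y _ => ?_
    rw [hK y x]
    ring
  have hin : ∀ x, ∑ y ∈ S, (w y + t * c y) * K x y =
      ∑ y ∈ S, w y * K x y + t * ∑ y ∈ S, c y * K x y := by
    intro x
    rw [Finset.mul_sum, ← Finset.sum_add_distrib]
    exact Finset.sum_congr rfl fun y _ => by ring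
  have hout : finEnergy K S (fun x => w x + t * c x) =
      ∑ x ∈ S, (w x * ∑ y ∈ S, w y * K x y + t * (c x * ∑ y ∈ S, w y * K x y)
        + t * (w x * ∑ y ∈ S, c y * K x y) + t ^ 2 * (c x * ∑ y ∈ S, c y * K x y)) := by
    refine Finset.sum_congr rfl fun x _ => ?_
    rw [hin]
    ring
  rw [hout]
  simp only [Finset.sum_add_distrib, ← Finset.mul_sum, hsymm]
  unfold finEnergy
  ring

theorem finEnergy_erase [DecidableEq α] (K : α → α → ℝ) {S : Finset α} {w : α → ℝ} {x₀ : α}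
    (h0 : w x₀ = 0) : finEnergy K (S.erase x₀) w = finEnergy K S w := by
  have h : ∀ g : α → ℝ, ∑ x ∈ S.erase x₀, w x * g x = ∑ x ∈ S, w x * g x := fun g =>
    Finset.sum_erase S (by rw [h0, zero_mul])
  unfold finEnergy
  rw [h]
  simp only [h]

/-- One can move along a negative direction of the energy until a weight vanishes. -/
theorem exists_weight_eq_zero {K : α → α → ℝ} (hK : ∀ x y, K x y = K y x) {S : Finset α}
    {w c : α → ℝ} (hw : IsProbWeight S w) (hc : ∃ x ∈ S, c x ≠ 0) (hc0 : ∑ x ∈ S, c x = 0)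
    (hcK : finEnergy K S c ≤ 0) :
    ∃ w', IsProbWeight S w' ∧ finEnergy K S w' ≤ finEnergy K S w ∧ ∃ x ∈ S, w' x = 0 := by
  -- The quadratic term is even in `c`, so the sign of `c` can be chosen to make the linear term
  -- nonpositive.
  wlog hcross : ∑ x ∈ S, w x * ∑ y ∈ S, c y * K x y ≤ 0 generalizing c
  · obtain ⟨x, hx, hx0⟩ := hc
    refine this (c := fun x => -c x) ⟨x, hx, neg_ne_zero.2 hx0⟩ (by simp [hc0]) ?_ ?_
    · simpa [finEnergy] using hcK
    · push Not at hcross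
      simp only [neg_mul, Finset.sum_neg_distrib, mul_neg]
      linarith
  have hneg : (S.filter fun x => c x < 0).Nonempty := by
    by_contra! hempty
    have hnn : ∀ x ∈ S, 0 ≤ c x := fun x hx => by
      by_contra! hlt
      have : x ∈ S.filter fun x => c x < 0 := Finset.mem_filter.2 ⟨hx, hlt⟩
      simp [hempty] at this
    obtain ⟨x, hx, hx0⟩ := hc
    exact hx0 ((Finset.sum_eq_zero_iff_of_nonneg hnn).1 hc0 x hx)
  -- The minimal ratio is the first time at which a weight reaches zero.
  obtain ⟨x₀, hx₀, hmin⟩ := Finset.exists_min_image _ (fun x => w x / -c x) hneg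
  obtain ⟨hx₀S, hx₀c⟩ := Finset.mem_filter.1 hx₀
  set t := w x₀ / -c x₀ with ht
  have ht0 : 0 ≤ t := div_nonneg (hw.1 x₀ hx₀S) (by linarith)
  refine ⟨fun x => w x + t * c x, ⟨fun x hx => ?_, ?_⟩, ?_, x₀, hx₀S, ?_⟩
  · rcases lt_or_ge (c x) 0 with hlt | hge
    · have h := hmin x (Finset.mem_filter.2 ⟨hx, hlt⟩)
      rw [le_div_iff₀ (by linarith)] at h
      linarith
    · have := hw.1 x hx
      positivity
  · rw [Finset.sum_add_distrib, ← Finset.mul_sum, hc0, hw.2]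
    ring
  · rw [finEnergy_add_mul hK]
    nlinarith [mul_nonneg ht0 (neg_nonneg.2 hcross), mul_nonneg (sq_nonneg t) (neg_nonneg.2 hcK)]
  · have : c x₀ ≠ 0 := hx₀c.ne
    rw [ht]
    field_simp
    ring

/-- Reduction of the support of a finite configuration without raising the energy. -/
theorem exists_card_le_finEnergy_le {K : α → α → ℝ} (hK : ∀ x y, K x y = K y x) {M : ℕ}
    (hM : ∀ S : Finset α, M < S.card →
      ∃ c : α → ℝ, (∃ x ∈ S, c x ≠ 0) ∧ ∑ x ∈ S, c x = 0 ∧ finEnergy K S c ≤ 0)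
    (S : Finset α) (w : α → ℝ) (hw : IsProbWeight S w) :
    ∃ (T : Finset α) (v : α → ℝ), T.card ≤ M ∧ IsProbWeight T v ∧
      finEnergy K T v ≤ finEnergy K S w := by
  classical
  induction hn : S.card using Nat.strong_induction_on generalizing S w with
  | _ n ih =>
    by_cases hcard : S.card ≤ M
    · exact ⟨S, w, hcard, hw, le_rfl⟩
    obtain ⟨c, hc, hc0, hcK⟩ := hM S (not_le.1 hcard)
    obtain ⟨v, hv, hle, x, hx, hx0⟩ := exists_weight_eq_zero hK hw hc hc0 hcK
    have hv' : IsProbWeight (S.erase x) v :=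
      ⟨fun y hy => hv.1 y (Finset.mem_of_mem_erase hy), by rw [Finset.sum_erase _ hx0, hv.2]⟩
    obtain ⟨T, u, hT, hu, hTu⟩ := ih _ (hn ▸ Finset.card_erase_lt_of_mem hx) _ v hv' rfl
    exact ⟨T, u, hT, hu, hTu.trans ((finEnergy_erase K hx0).trans_le hle)⟩

/-- The energy of a configuration of `M` points with weights. -/
def tupleEnergy (K : α → α → ℝ) {M : ℕ} (x : Fin M → α) (w : Fin M → ℝ) : ℝ :=
  ∑ i, w i * ∑ j, w j * K (x i) (x j)

/-- Padding with points of weight zero puts all small configurations in one fixed compact space. -/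
theorem exists_tuple_of_card_le [Nonempty α] (K : α → α → ℝ) {M : ℕ} {S : Finset α} {w : α → ℝ}
    (hS : S.card ≤ M) (hw : IsProbWeight S w) :
    ∃ x : Fin M → α, ∃ v ∈ stdSimplex ℝ (Fin M), tupleEnergy K x v = finEnergy K S w := by
  classical
  obtain ⟨e⟩ : Nonempty (S ↪ Fin M) := Function.Embedding.nonempty_of_card_le (by simpa using hS)
  set x : Fin M → α := Function.extend e Subtype.val fun _ => Classical.arbitrary α with hx
  set v : Fin M → ℝ := fun i => ∑ y : S, if e y = i then w y else 0 with hv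
  have hsum : ∀ g : α → ℝ, ∑ i, v i * g (x i) = ∑ y ∈ S, w y * g y := by
    intro g
    simp only [hv, Finset.sum_mul, ite_mul, zero_mul]
    rw [Finset.sum_comm, ← Finset.sum_coe_sort S fun y => w y * g y]
    refine Finset.sum_congr rfl fun y _ => ?_
    rw [Finset.sum_ite_eq, if_pos (Finset.mem_univ _), hx, e.injective.extend_apply]
  refine ⟨x, v, ⟨fun i => Finset.sum_nonneg fun y _ => ?_, ?_⟩, ?_⟩
  · split_ifs
    · exact hw.1 y y.2
    · exact le_rfl
  · simpa [hw.2] using hsum fun _ => 1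
  · rw [tupleEnergy, finEnergy, ← hsum fun a => ∑ y ∈ S, w y * K a y]
    exact Finset.sum_congr rfl fun i _ => by rw [hsum fun b => K (x i) b]

/-- Continuity on a compact space gives a minimum over `M`-tuples; support reduction extends its
bound to all finite configurations. -/
theorem exists_tuple_minimizer [TopologicalSpace α] [CompactSpace α] [Nonempty α]
    {K : α → α → ℝ} (hKc : Continuous fun p : α × α => K p.1 p.2)
    (hK : ∀ x y, K x y = K y x) {M : ℕ}
    (hM : ∀ S : Finset α, M < S.card →
      ∃ c : α → ℝ, (∃ x ∈ S, c x ≠ 0) ∧ ∑ x ∈ S, c x = 0 ∧ finEnergy K S c ≤ 0) :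
    ∃ x : Fin M → α, ∃ v ∈ stdSimplex ℝ (Fin M), ∀ (S : Finset α) (w : α → ℝ),
      IsProbWeight S w → tupleEnergy K x v ≤ finEnergy K S w := by
  have hreach : ∀ (S : Finset α) (w : α → ℝ), IsProbWeight S w →
      ∃ x : Fin M → α, ∃ v ∈ stdSimplex ℝ (Fin M), tupleEnergy K x v ≤ finEnergy K S w := by
    intro S w hw
    obtain ⟨T, u, hT, hu, hle⟩ := exists_card_le_finEnergy_le hK hM S w hw
    obtain ⟨x, v, hv, he⟩ := exists_tuple_of_card_le K hT hu
    exact ⟨x, v, hv, he.trans_le hle⟩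
  have hcomp : IsCompact ((univ : Set (Fin M → α)) ×ˢ stdSimplex ℝ (Fin M)) :=
    isCompact_univ.prod (isCompact_stdSimplex ℝ _)
  have hcont : Continuous fun p : (Fin M → α) × (Fin M → ℝ) => tupleEnergy K p.1 p.2 := by
    unfold tupleEnergy
    refine continuous_finsetSum _ fun i _ => Continuous.mul (by fun_prop)
      (continuous_finsetSum _ fun j _ => Continuous.mul (by fun_prop) ?_)
    exact hKc.comp (by fun_prop :
      Continuous fun p : (Fin M → α) × (Fin M → ℝ) => (p.1 i, p.1 j))
  obtain ⟨x₁, v₁, hv₁, -⟩ := hreach {Classical.arbitrary α} (fun _ => 1) ⟨by simp, by simp⟩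
  obtain ⟨⟨x, v⟩, hxv, hmin⟩ := hcomp.exists_isMinOn ⟨(x₁, v₁), trivial, hv₁⟩ hcont.continuousOn
  refine ⟨x, v, hxv.2, fun S w hw => ?_⟩
  obtain ⟨y, u, hu, hle⟩ := hreach S w hw
  exact le_trans (hmin (⟨trivial, hu⟩ : (y, u) ∈ univ ×ˢ stdSimplex ℝ (Fin M))) hle

end FiniteEnergy

/-! ### Approximation of arbitrary measures by finite configurations. -/

section Approximation

theorem integral_comp_simpleFunc {α β : Type*} [MeasurableSpace β] (ν : Measure β)
    [IsFiniteMeasure ν] (g : SimpleFunc β α) (h : α → ℝ) :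
    ∫ x, h (g x) ∂ν = ∑ y ∈ g.range, ν.real (g ⁻¹' {y}) * h y := by
  have he : ∀ x, h (g x) = ∑ y ∈ g.range, (g ⁻¹' {y}).indicator (fun _ => h y) x := by
    intro x
    rw [Finset.sum_eq_single_of_mem (g x) (g.mem_range_self x)]
    · simp
    · intro y _ hy
      exact indicator_of_notMem (fun hx => hy hx.symm) _
  simp_rw [he]
  rw [integral_finsetSum _ fun y _ =>
    (integrable_const (h y)).indicator (g.measurableSet_fiber y)]
  refine Finset.sum_congr rfl fun y _ => ?_
  rw [integral_indicator_const _ (g.measurableSet_fiber y), smul_eq_mul]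

variable {α : Type*} [PseudoMetricSpace α] [CompactSpace α] [Nonempty α] [MeasurableSpace α]
  [BorelSpace α]

/-- Rounding to nearest points of a dense sequence pushes `ν` to finite configurations; dominated
convergence, applied twice, passes to the limit. -/
theorem le_integral_integral {K : α → α → ℝ} (hKc : Continuous fun p : α × α => K p.1 p.2)
    {m : ℝ} (hm : ∀ (S : Finset α) (w : α → ℝ), IsProbWeight S w → m ≤ finEnergy K S w)
    (ν : Measure α) [IsProbabilityMeasure ν] : m ≤ ∫ x, ∫ y, K x y ∂ν ∂ν := by
  obtain ⟨C, hC⟩ : ∃ C, ∀ x y, |K x y| ≤ C := by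
    obtain ⟨C, hC⟩ := isCompact_univ.exists_bound_of_continuousOn hKc.continuousOn
    exact ⟨C, fun x y => hC (x, y) trivial⟩
  set g : ℕ → SimpleFunc α α := SimpleFunc.nearestPt (TopologicalSpace.denseSeq α) with hg
  have hgx : ∀ x, Tendsto (fun k => g k x) atTop (𝓝 x) := fun x =>
    SimpleFunc.tendsto_nearestPt (TopologicalSpace.denseRange_denseSeq α x)
  have hle : ∀ k, m ≤ ∫ x, ∫ y, K (g k x) (g k y) ∂ν ∂ν := by
    intro k
    have h1 : ∀ x, ∫ y, K (g k x) (g k y) ∂ν =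
        ∑ y ∈ (g k).range, ν.real (g k ⁻¹' {y}) * K (g k x) y := fun x =>
      integral_comp_simpleFunc ν (g k) (K (g k x))
    simp_rw [h1]
    rw [integral_comp_simpleFunc ν (g k)
      fun a => ∑ y ∈ (g k).range, ν.real (g k ⁻¹' {y}) * K a y]
    refine hm (g k).range (fun y => ν.real (g k ⁻¹' {y})) ⟨fun _ _ => measureReal_nonneg, ?_⟩
    have := integral_comp_simpleFunc ν (g k) fun _ => 1
    simpa using this.symm
  have hinner : ∀ x, Tendsto (fun k => ∫ y, K (g k x) (g k y) ∂ν) atTop (𝓝 (∫ y, K x y ∂ν)) := by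
    intro x
    refine tendsto_integral_of_dominated_convergence (fun _ => C) (fun k => ?_)
      (integrable_const C) (fun k => ae_of_all _ fun y => hC _ _) (ae_of_all _ fun y => ?_)
    · exact ((g k).map (K (g k x))).aestronglyMeasurable
    · exact (hKc.tendsto (x, y)).comp ((hgx x).prodMk_nhds (hgx y))
  have hint : Tendsto (fun k => ∫ x, ∫ y, K (g k x) (g k y) ∂ν ∂ν) atTop
      (𝓝 (∫ x, ∫ y, K x y ∂ν ∂ν)) := by
    refine tendsto_integral_of_dominated_convergence (fun _ => C) (fun k => ?_)
      (integrable_const C) (fun k => ae_of_all _ fun x => ?_) (ae_of_all _ hinner)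
    · exact ((g k).map fun a => ∫ y, K a (g k y) ∂ν).aestronglyMeasurable
    · have := norm_integral_le_of_norm_le_const (μ := ν) (f := fun y => K (g k x) (g k y))
        (ae_of_all _ fun y => hC (g k x) (g k y))
      simpa using this
  exact ge_of_tendsto' hint hle

end Approximation

end SphereEnergy

/-! ### Application to the sphere. -/

namespace SphereEnergy

open Set Filter Topology

variable {d : ℕ}

/-- The kernel `f(⟨x, y⟩)` on the sphere. -/
noncomputable def sphereKernel (d : ℕ) (f : ℝ → ℝ) (x y : Sphere d) : ℝ :=
  f (inner ℝ (x : EuclideanSpace ℝ (Fin d)) (y : EuclideanSpace ℝ (Fin d)))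

theorem inner_sphere_mem_Icc (x y : Sphere d) :
    inner ℝ (x : EuclideanSpace ℝ (Fin d)) (y : EuclideanSpace ℝ (Fin d)) ∈ Icc (-1 : ℝ) 1 := by
  have h := abs_real_inner_le_norm (x : EuclideanSpace ℝ (Fin d)) (y : EuclideanSpace ℝ (Fin d))
  rw [norm_eq_of_mem_sphere, norm_eq_of_mem_sphere, one_mul] at h
  exact abs_le.1 h

theorem continuous_sphereKernel {f : ℝ → ℝ} (hf : ContinuousOn f (Icc (-1) 1)) :
    Continuous fun p : Sphere d × Sphere d => sphereKernel d f p.1 p.2 :=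
  hf.comp_continuous (f := fun p : Sphere d × Sphere d =>
    inner ℝ (p.1 : EuclideanSpace ℝ (Fin d)) (p.2 : EuclideanSpace ℝ (Fin d))) (by fun_prop)
    fun p => inner_sphere_mem_Icc p.1 p.2

theorem sphereKernel_comm (f : ℝ → ℝ) (x y : Sphere d) :
    sphereKernel d f x y = sphereKernel d f y x := by
  rw [sphereKernel, sphereKernel, real_inner_comm]

instance finite_sphericalHarmonics (d n : ℕ) : Module.Finite ℝ (sphericalHarmonics d n) := by
  have h1 : Module.Finite ℝ (MvPolynomial.homogeneousSubmodule (Fin d) ℝ n) :=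
    Module.Finite.iff_fg.2 (MvPolynomial.homogeneousSubmodule_fg (σ := Fin d) ℝ n)
  have h2 : Module.Finite ℝ ((MvPolynomial.homogeneousSubmodule (Fin d) ℝ n ⊓
      LinearMap.ker (polyLaplacian d) : Submodule ℝ (MvPolynomial (Fin d) ℝ))) :=
    Submodule.finiteDimensional_of_le inf_le_left
  unfold sphericalHarmonics
  infer_instance

theorem one_mem_sphericalHarmonics_zero : (fun _ => 1) ∈ sphericalHarmonics d 0 := by
  refine ⟨1, ⟨MvPolynomial.isHomogeneous_one _ _, ?_⟩, ?_⟩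
  · change polyLaplacian d 1 = 0
    simp [polyLaplacian_apply]
  · ext x
    simp [restrictToSphere]

/-- A signed measure annihilating the spherical harmonics of all degrees with positive coefficient
has nonpositive energy. -/
theorem finEnergy_nonpos (hd : 2 ≤ d) {f : ℝ → ℝ} (hf : ContinuousOn f (Icc (-1) 1))
    (S : Finset (Sphere d)) (c : Sphere d → ℝ)
    (hc : ∀ n, 0 < coeff d f n → ∀ Y ∈ sphericalHarmonics d n, ∑ x ∈ S, c x * Y x = 0) :
    finEnergy (sphereKernel d f) S c ≤ 0 := by
  have hP := fun n => isUltraspherical_zonal hd n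
  have h := sum_mul_nonpos_of_ultraCoeff (lam_nonneg hd) hP hf (S ×ˢ S)
    (fun p => c p.1 * c p.2) (fun p => inner ℝ (p.1 : EuclideanSpace ℝ (Fin d))
      (p.2 : EuclideanSpace ℝ (Fin d))) (fun p _ => inner_sphere_mem_Icc p.1 p.2) ?_
  · rw [Finset.sum_product] at h
    convert h using 1
    refine Finset.sum_congr rfl fun x _ => ?_
    rw [Finset.mul_sum]
    exact Finset.sum_congr rfl fun y _ => (mul_assoc _ _ _).symm
  · intro n
    rw [Finset.sum_product, ← coeff_eq_ultraCoeff]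
    -- For a positive coefficient the zonal functions are annihilated by `c`; otherwise Schoenberg
    -- positivity gives the sign.
    by_cases hn : 0 < coeff d f n
    · refine (mul_eq_zero_of_right _ (Finset.sum_eq_zero fun x _ => ?_)).le
      simp only [mul_assoc, ← Finset.mul_sum]
      rw [hc n hn _ (zonal_mem_sphericalHarmonics hd (hP n) x), mul_zero]
    · exact mul_nonpos_of_nonpos_of_nonneg (not_lt.1 hn)
        (sum_sum_eval_inner_nonneg hd (hP n) S c)

/-- A large finite set carries a nontrivial signed measure annihilating finitely many spaces of
spherical harmonics. -/
theorem exists_annihilating (F : Finset ℕ) (S : Finset (Sphere d))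
    (hS : ∑ n ∈ F, Module.finrank ℝ (sphericalHarmonics d n) < S.card) :
    ∃ c : Sphere d → ℝ, (∃ x ∈ S, c x ≠ 0) ∧
      ∀ n ∈ F, ∀ Y ∈ sphericalHarmonics d n, ∑ x ∈ S, c x * Y x = 0 := by
  classical
  -- A weight is sent to the functionals it induces on each harmonic space; the kernel is nontrivial
  -- by dimension count.
  let T : (S → ℝ) →ₗ[ℝ] ((n : F) → Module.Dual ℝ (sphericalHarmonics d n)) :=
    LinearMap.pi fun n => ∑ x : S,
      (LinearMap.proj x : (S → ℝ) →ₗ[ℝ] ℝ).smulRight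
        ((LinearMap.proj (x : Sphere d) : (Sphere d → ℝ) →ₗ[ℝ] ℝ) ∘ₗ
          (sphericalHarmonics d n).subtype)
  have hT : ∀ c (n : F) (Y : sphericalHarmonics d n), T c n Y = ∑ x : S, c x * Y.1 x := by
    intro c n Y
    simp [T]
  have hker : LinearMap.ker T ≠ ⊥ := by
    refine T.ker_ne_bot_of_finrank_lt ?_
    rw [Module.finrank_pi_fintype, Module.finrank_fintype_fun_eq_card, Fintype.card_coe]
    simp only [Subspace.dual_finrank_eq]
    rwa [Finset.sum_coe_sort F fun n => Module.finrank ℝ (sphericalHarmonics d n)]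
  obtain ⟨c, hc, hc0⟩ := (Submodule.ne_bot_iff _).1 hker
  obtain ⟨x, hx⟩ := Function.ne_iff.1 hc0
  refine ⟨fun y => if h : y ∈ S then c ⟨y, h⟩ else 0, ⟨x, x.2, by simpa using hx⟩, ?_⟩
  intro n hn Y hY
  have h := hT c ⟨n, hn⟩ ⟨Y, hY⟩
  rw [LinearMap.mem_ker.1 hc] at h
  rw [← Finset.sum_coe_sort]
  simpa using h.symm

/-- The measure with weights `v` at the points `x`. -/
noncomputable def tupleMeasure {M : ℕ} (x : Fin M → Sphere d) (v : Fin M → ℝ) :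
    Measure (Sphere d) :=
  ∑ i, ENNReal.ofReal (v i) • Measure.dirac (x i)

theorem isProbabilityMeasure_tupleMeasure {M : ℕ} (x : Fin M → Sphere d) {v : Fin M → ℝ}
    (hv : v ∈ stdSimplex ℝ (Fin M)) : IsProbabilityMeasure (tupleMeasure x v) := by
  constructor
  simp only [tupleMeasure, Measure.finsetSum_apply, Measure.smul_apply, measure_univ,
    smul_eq_mul, mul_one]
  rw [← ENNReal.ofReal_sum_of_nonneg fun i _ => hv.1 i, hv.2, ENNReal.ofReal_one]

theorem integral_tupleMeasure {M : ℕ} (x : Fin M → Sphere d) {v : Fin M → ℝ}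
    (hv : v ∈ stdSimplex ℝ (Fin M)) (g : Sphere d → ℝ) :
    ∫ y, g y ∂tupleMeasure x v = ∑ i, v i * g (x i) := by
  rw [tupleMeasure, integral_finsetSum_measure fun i _ =>
    (integrable_dirac (by finiteness)).smul_measure ENNReal.ofReal_ne_top]
  refine Finset.sum_congr rfl fun i _ => ?_
  rw [integral_smul_measure, integral_dirac, ENNReal.toReal_ofReal (hv.1 i), smul_eq_mul]

theorem encard_support_tupleMeasure_le {M : ℕ} (x : Fin M → Sphere d) (v : Fin M → ℝ) :
    (tupleMeasure x v).support.encard ≤ M := by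
  have hsub : (tupleMeasure x v).support ⊆ range x := by
    refine Measure.support_subset_of_isClosed (finite_range x).isClosed ?_
    rw [mem_ae_iff]
    simp only [tupleMeasure, Measure.finsetSum_apply, Measure.smul_apply, smul_eq_mul]
    refine Finset.sum_eq_zero fun i _ => ?_
    rw [Measure.dirac_apply' _ (finite_range x).measurableSet.compl]
    simp
  calc (tupleMeasure x v).support.encard ≤ (range x).encard := encard_le_encard hsub
    _ ≤ (univ : Set (Fin M)).encard := by
      rw [← image_univ]
      exact encard_image_le _ _
    _ = M := by simp

theorem isDiscrete_tupleMeasure {M : ℕ} (x : Fin M → Sphere d) {v : Fin M → ℝ}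
    (hv : v ∈ stdSimplex ℝ (Fin M)) :
    IsDiscrete ⟨tupleMeasure x v, isProbabilityMeasure_tupleMeasure x hv⟩ := by
  classical
  -- Points of the tuple may coincide, so their weights are collected over fibres.
  refine ⟨Finset.univ.image x,
    fun y => ∑ i ∈ Finset.univ.filter fun i => x i = y, ENNReal.ofReal (v i), ?_⟩
  change tupleMeasure x v = _
  rw [tupleMeasure, ← Finset.sum_fiberwise_of_maps_to (t := Finset.univ.image x) (g := x)
    fun i hi => Finset.mem_image_of_mem x hi]
  refine Finset.sum_congr rfl fun y _ => ?_
  rw [Finset.sum_smul]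
  refine Finset.sum_congr rfl fun i hi => ?_
  rw [(Finset.mem_filter.1 hi).2]

theorem exists_discrete_minimizer (hd : 2 ≤ d) {f : ℝ → ℝ} (hf : ContinuousOn f (Icc (-1) 1))
    (hpos : (posDegrees d f).Finite) :
    ∃ μ : ProbabilityMeasure (Sphere d), IsDiscrete μ ∧
      (μ : Measure (Sphere d)).support.encard ≤
        ((∑ n ∈ insert 0 hpos.toFinset,
            Module.finrank ℝ (sphericalHarmonics d n) : ℕ) : ℕ∞) ∧
      ∀ ν : ProbabilityMeasure (Sphere d), energy d f μ ≤ energy d f ν := by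
  have : NeZero d := ⟨by lia⟩
  have : Nonempty (Sphere d) := (NormedSpace.sphere_nonempty.2 zero_le_one).to_subtype
  obtain ⟨x, v, hv, hmin⟩ := exists_tuple_minimizer (continuous_sphereKernel (d := d) hf)
    (sphereKernel_comm f)
    (M := ∑ n ∈ insert 0 hpos.toFinset, Module.finrank ℝ (sphericalHarmonics d n)) (by
      intro S hS
      obtain ⟨c, hc, hann⟩ := exists_annihilating _ S hS
      refine ⟨c, hc, ?_, finEnergy_nonpos hd hf S c fun n hn => hann n ?_⟩
      -- Annihilating the constants means total mass zero, which is why degree `0` is always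
      -- included.
      · simpa using hann 0 (Finset.mem_insert_self _ _) _ one_mem_sphericalHarmonics_zero
      · exact Finset.mem_insert_of_mem (hpos.mem_toFinset.2 hn))
  refine ⟨⟨tupleMeasure x v, isProbabilityMeasure_tupleMeasure x hv⟩,
    isDiscrete_tupleMeasure x hv, encard_support_tupleMeasure_le x v, fun ν => ?_⟩
  have hE : energy d f ⟨tupleMeasure x v, isProbabilityMeasure_tupleMeasure x hv⟩ =
      tupleEnergy (sphereKernel d f) x v := by
    change ∫ y, ∫ z, sphereKernel d f y z ∂tupleMeasure x v ∂tupleMeasure x v = _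
    simp_rw [integral_tupleMeasure x hv]
    rfl
  rw [hE]
  exact le_integral_integral (continuous_sphereKernel hf) hmin ν

end SphereEnergy

theorem theorem3p3 (d : ℕ) (hd : 2 ≤ d) (f : ℝ → ℝ)
    (hf : ContinuousOn f (Set.Icc (-1) 1))
    (hpos : (SphereEnergy.posDegrees d f).Finite) :
    ∃ μ : MeasureTheory.ProbabilityMeasure (SphereEnergy.Sphere d),
      SphereEnergy.IsDiscrete μ ∧
      (μ : MeasureTheory.Measure (SphereEnergy.Sphere d)).support.encard ≤
        ((∑ n ∈ insert 0 hpos.toFinset,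
            Module.finrank ℝ (SphereEnergy.sphericalHarmonics d n) : ℕ) : ℕ∞) ∧
      ∀ ν : MeasureTheory.ProbabilityMeasure (SphereEnergy.Sphere d),
        SphereEnergy.energy d f μ ≤ SphereEnergy.energy d f ν :=
  SphereEnergy.exists_discrete_minimizer hd hf hpos
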